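/- Let $(q;q)_\infty=\prod_{i\ge 1}(1-q^{i})$, let $p(n)$ be the number of partitions of $n$ for $n\ge 0$ and $p(n)=0$ for $n<0$, and let $\chi_{3,5}$ be the Dirichlet character modulo $5$ with values $0,1,-1,-1,1$ at $0,1,2,3,4$. Define the series $$L_{2,\chi_{3,5}}(q)=\sum_{n\ge 1}\frac{n}{1-q^{5n}}\sum_{m=1}^{4}\chi_{3,5}(m)q^{mn},\qquad E_{2,\chi_{3,5}}(q)=1+\frac{2}{L(-1,\chi_{3,5})}\sum_{n\ge 1}\chi_{3,5}(n)\frac{n\,q^{n}}{1-q^{n}},$$ where $L(s,\chi_{3,5})$ is the analytically continued Dirichlet $L$-function, and the operators $\Omega_{5,m}\bigl(\sum_{n\ge0} a_nq^n\bigr)=\sum_{n\ge0} a_{5n+m}q^n$ for $0\le m\le 4$. Put $F_0=L_{2,\chi_{3,5}}$ and, for $n\ge 1$ and $0\le m\le 4$, $$F_n=L_{2,\chi_{3,5}}^{5^n}\cdot\Omega_{5,0}(F_{n-1}),\qquad F_{n,m}=\Omega_{5,m}(F_n)=\Omega_{5,m}\bigl(L_{2,\chi_{3,5}}^{5^n}\cdot\Omega_{5,0}(F_{n-1})\bigr).$$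 Let $\chi(k)=1$ for odd $k$ and $\chi(k)=0$ for even $k$, and let $\delta_k$ be the integer with $0\le\delta_k<5^k$ and $24\delta_k\equiv 1\pmod{5^k}$. **Theorem.** For every integer $k\ge 2$ and $m=0,1,2,3,4$, the denominator on the right below is a nonzero power series, and $$(q;q)_\infty^{5^{\chi(k)}}\sum_{n=-1}^{\infty}p\bigl(5^kn+\delta_k+5^{k-1}m\bigr)q^{n+1}=\frac{F_{k-1,m}(q)}{\prod_{j=0}^{\lfloor k/2\rfloor-1}E_{2,\chi_{3,5}}^{5^{2j+1+\chi(k)}}(q)\,L_{2,\chi_{3,5}}^{5^{2j+\chi(k)}}(q)}$$ as an identity of formal (Laurent) series in $q$ with complex coefficients. -/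

import Mathlib

namespace QuinticPartition

noncomputable section

open PowerSeries
open scoped PowerSeries.WithPiTopology

/-- The values at `0, 1, 2, 3, 4` of the even quadratic character modulo five, over `ℤ`. -/
def chi35Int : MulChar (ZMod 5) ℤ where
  toFun := ![0, 1, -1, -1, 1]
  map_one' := rfl
  map_mul' := by decide
  map_nonunit' := by
    intro a ha
    have h : a = 0 := by
      by_contra h
      exact ha (by
        have h2 : ∀ a : ZMod 5, a ≠ 0 → ∃ b, a * b = 1 := by decide
        obtain ⟨b, hb⟩ := h2 a h
        exact IsUnit.of_mul_eq_one b hb)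
    subst h
    rfl

/-- The Dirichlet character `χ_{3,5}` modulo five with values `0, 1, -1, -1, 1`. -/
def chi35 : DirichletCharacter ℂ 5 := chi35Int.ringHomComp (Int.castRingHom ℂ)

/-- The `n`-th term `n / (1 - q^{5n}) * ∑_{m=1}^{4} χ(m) q^{mn}` of `L_{2,χ}(q)`. -/
def lTerm (χ : DirichletCharacter ℂ 5) (n : ℕ) : ℂ⟦X⟧ :=
  C (n : ℂ) * (1 - X ^ (5 * n))⁻¹ * ∑ m ∈ Finset.Icc (1 : ℕ) 4, C (χ (m : ZMod 5)) * X ^ (m * n)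

/-- `L_{2,χ}(q) = ∑_{n ≥ 1} n / (1 - q^{5n}) * ∑_{m=1}^{4} χ(m) q^{mn}` as a formal power series
(the sum converges coefficientwise). -/
def lSeries (χ : DirichletCharacter ℂ 5) : ℂ⟦X⟧ := ∑' n : ℕ, lTerm χ (n + 1)

/-- The `n`-th term `χ(n) n q^n / (1 - q^n)` of the Lambert series in `E_{2,χ}(q)`. -/
def eTerm (χ : DirichletCharacter ℂ 5) (n : ℕ) : ℂ⟦X⟧ :=
  C (χ (n : ZMod 5) * (n : ℂ)) * X ^ n * (1 - X ^ n)⁻¹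

/-- `E_{2,χ}(q) = 1 + 2 / L(-1, χ) * ∑_{n ≥ 1} χ(n) n q^n / (1 - q^n)` as a formal power series;
`L(s, χ)` is the analytically continued Dirichlet `L`-function. -/
def eSeries (χ : DirichletCharacter ℂ 5) : ℂ⟦X⟧ :=
  1 + C (2 / DirichletCharacter.LFunction χ (-1)) * ∑' n : ℕ, eTerm χ (n + 1)

/-- The series `L_{2,χ_{3,5}}(q)`. -/
def L : ℂ⟦X⟧ := lSeries chi35

/-- The series `E_{2,χ_{3,5}}(q)`. -/
def E : ℂ⟦X⟧ := eSeries chi35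

/-- The Euler product `(q;q)_∞ = ∏_{i ≥ 0} (1 - q^{i+1})`. -/
def euler : ℂ⟦X⟧ := ∏' i : ℕ, (1 - X ^ (i + 1))

/-- The quintic multisection operator `Ω_{5,m} (∑ a_n q^n) = ∑ a_{5n+m} q^n`. -/
def Omega (m : ℕ) (f : ℂ⟦X⟧) : ℂ⟦X⟧ := PowerSeries.mk fun n => coeff (5 * n + m) f

/-- `F_0 = L_{2,χ_{3,5}}` and `F_n = L_{2,χ_{3,5}}^{5^n} * Ω_{5,0}(F_{n-1})` for `n ≥ 1`. -/
def F : ℕ → ℂ⟦X⟧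
  | 0 => L
  | n + 1 => L ^ (5 ^ (n + 1)) * Omega 0 (F n)

/-- `F_{n,m} = Ω_{5,m}(F_n)`; for `n ≥ 1` this is `Ω_{5,m}(L^{5^n} * Ω_{5,0}(F_{n-1}))`. -/
def Fm (n m : ℕ) : ℂ⟦X⟧ := Omega m (F n)

/-- The principal character modulo two, with values in `{0, 1} ⊆ ℕ`. -/
def chi2 (k : ℕ) : ℕ := if Nat.Coprime k 2 then 1 else 0

/-- The number `p(n)` of partitions of the integer `n`; it is `0` for negative `n`. -/
def partitionCount (n : ℤ) : ℕ := if 0 ≤ n then Fintype.card (Nat.Partition n.toNat) else 0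

/-- `∑_{n ≥ -1} p(5^k n + δ + 5^{k-1} m) q^{n+1}`, for `k ≥ 1`. -/
def partitionSeries (k δ m : ℕ) : ℂ⟦X⟧ :=
  PowerSeries.mk fun N =>
    (partitionCount (5 ^ k * ((N : ℤ) - 1) + (δ : ℤ) + 5 ^ (k - 1) * (m : ℤ)) : ℂ)

/-- `∏_{j=0}^{⌊k/2⌋-1} E_{2,χ_{3,5}}^{5^{2j+1+χ(k)}} L_{2,χ_{3,5}}^{5^{2j+χ(k)}}`, with `χ` the
principal character modulo two. -/
def denom (k : ℕ) : ℂ⟦X⟧ :=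
  ∏ j ∈ Finset.range (k / 2), E ^ (5 ^ (2 * j + 1 + chi2 k)) * L ^ (5 ^ (2 * j + chi2 k))

end

end QuinticPartition

namespace QuinticPartition

open PowerSeries Filter Finset
open scoped PowerSeries.WithPiTopology Topology

noncomputable section

/-! ### Limits of formal power series -/

/-! Write P_d for the product of the 1 - q^{di}, i ≥ 1. Everything rests on two eta quotients: L·P_1
= q·P_5^5 (`L_mul_euler`) and E·P_5 = P_1^5 (`E_mul_eulerPow_five`).

Granted these, Euler's formula ∑ p(n) q^n = 1/P_1 gives F_0, and since Ω_{5,m} turns a factor P_5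
into P_1, induction gives F_n = P_5^{5^{n+1}} ∑ p(5^n N - s) q^N with s = (25^{n+1} - 1)/24
(`F_eq`). One more multisection yields F_{k-1,m}. The denominator telescopes to q^D P_1^{5^k -
5^{χ(k)}} with 24D = 5^k - 5^{χ(k)} (`prod_mul_euler_pow`), and q^D accounts exactly for the passage
from s to δ_k (`residue_eq`).

Both eta quotients are cases of the Weierstrass formula expressing ℘(y) - ℘(x) through
σ(x+y)σ(x-y)/(σ(x)²σ(y)²), proved here for formal theta series (`wpSum_sub_wpSum`). L is such a
difference for base q^5 at the points q, q²; E is one for base q at primitive fifth roots of unity.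
The formula follows from the product expansion of theta, which gives its second logarithmic
derivative (`thetaSum_logDeriv`), and from splitting θ(xy)θ(x/y) by parity (`theta_addition`), which
makes every term a 2×2 determinant. -/

theorem tendsto_of_X_pow_dvd {f : ℕ → ℂ⟦X⟧} {g : ℂ⟦X⟧} (h : ∀ N, X ^ N ∣ f N - g) :
    Tendsto f atTop (𝓝 g) := by
  rw [WithPiTopology.tendsto_iff_coeff_tendsto]
  intro d
  refine tendsto_atTop_of_eventually_const (i₀ := d + 1) fun N hN => ?_
  have := X_pow_dvd_iff.mp (h N) d (by omega)
  rwa [map_sub, sub_eq_zero] at this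

theorem X_pow_dvd_of_tendsto {f : ℕ → ℂ⟦X⟧} {g : ℂ⟦X⟧} (hf : Tendsto f atTop (𝓝 g)) {N : ℕ}
    (h : ∀ n, N ≤ n → X ^ N ∣ f n - f N) : X ^ N ∣ g - f N := by
  rw [X_pow_dvd_iff]
  intro m hm
  rw [map_sub, sub_eq_zero]
  refine tendsto_nhds_unique
    ((WithPiTopology.tendsto_iff_coeff_tendsto _ _ _ _).mp hf m)
    (tendsto_atTop_of_eventually_const (i₀ := N) fun n hn => ?_)
  have := X_pow_dvd_iff.mp (h n hn) m hm
  rwa [map_sub, sub_eq_zero] at this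

theorem summable_of_finite_coeff {ι : Type*} {f : ι → ℂ⟦X⟧}
    (h : ∀ k, {i | coeff k (f i) ≠ 0}.Finite) : Summable f := by
  rw [WithPiTopology.summable_iff_summable_coeff]
  intro k
  exact summable_of_hasFiniteSupport (h k)

theorem summable_of_X_pow_dvd {f : ℕ → ℂ⟦X⟧} (h : ∀ n, X ^ n ∣ f n) : Summable f := by
  refine summable_of_finite_coeff fun k => (Set.finite_Iic k).subset fun n hn => ?_
  by_contra hk
  exact hn (X_pow_dvd_iff.mp (h n) k (by simpa using hk))

/-! ### Euler products -/

/-- The finite product `∏_{i < k} (1 - q^{d(i+1)})`. -/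
def qPoch (d k : ℕ) : ℂ⟦X⟧ := ∏ i ∈ range k, (1 - X ^ (d * (i + 1)))

/-- The infinite product `∏_{i ≥ 0} (1 - q^{d(i+1)})`. -/
def eulerPow (d : ℕ) : ℂ⟦X⟧ := ∏' i : ℕ, (1 - X ^ (d * (i + 1)))

theorem eulerPow_one : eulerPow 1 = euler := by simp [eulerPow, euler]

theorem qPoch_succ (d k : ℕ) : qPoch d (k + 1) = qPoch d k * (1 - X ^ (d * (k + 1))) :=
  prod_range_succ _ _

theorem qPoch_zero (d : ℕ) : qPoch d 0 = 1 := prod_range_zero _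

variable {d : ℕ}

theorem constantCoeff_qPoch (hd : d ≠ 0) (k : ℕ) : constantCoeff (qPoch d k) = 1 := by
  simp [qPoch, map_prod, hd]

theorem multipliable_euler (hd : d ≠ 0) :
    Multipliable fun i : ℕ => (1 - X ^ (d * (i + 1)) : ℂ⟦X⟧) := by
  simp_rw [sub_eq_add_neg]
  apply WithPiTopology.multipliable_one_add_of_tendsto_order_atTop_nhds_top
  refine ENat.tendsto_nhds_top_iff_natCast_lt.mpr fun n => eventually_atTop.mpr ⟨n, fun m hm => ?_⟩
  rw [order_neg, order_X_pow]
  have : m + 1 ≤ d * (m + 1) := Nat.le_mul_of_pos_left _ (Nat.pos_of_ne_zero hd)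
  exact_mod_cast (by omega : n < d * (m + 1))

theorem tendsto_qPoch (hd : d ≠ 0) : Tendsto (qPoch d) atTop (𝓝 (eulerPow d)) :=
  (multipliable_euler hd).hasProd.tendsto_prod_nat

theorem X_pow_dvd_qPoch_sub (hd : d ≠ 0) {N n : ℕ} (h : N ≤ n) :
    X ^ N ∣ qPoch d n - qPoch d N := by
  induction n, h using Nat.le_induction with
  | base => simp
  | succ n hn ih =>
    have h1 : qPoch d (n + 1) - qPoch d N =
        (qPoch d n - qPoch d N) - X ^ (d * (n + 1)) * qPoch d n := by
      rw [qPoch_succ]; ring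
    rw [h1]
    refine dvd_sub ih (Dvd.dvd.mul_right (pow_dvd_pow _ ?_) _)
    have : n + 1 ≤ d * (n + 1) := Nat.le_mul_of_pos_left _ (Nat.pos_of_ne_zero hd)
    omega

theorem X_pow_dvd_eulerPow_sub (hd : d ≠ 0) (N : ℕ) : X ^ N ∣ eulerPow d - qPoch d N :=
  X_pow_dvd_of_tendsto (tendsto_qPoch hd) fun _ h => X_pow_dvd_qPoch_sub hd h

theorem constantCoeff_eulerPow (hd : d ≠ 0) : constantCoeff (eulerPow d) = 1 := by
  have h := X_pow_dvd_iff.mp (X_pow_dvd_eulerPow_sub hd 1) 0 one_pos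
  rw [map_sub, sub_eq_zero, coeff_zero_eq_constantCoeff_apply,
    coeff_zero_eq_constantCoeff_apply, constantCoeff_qPoch hd] at h
  exact h

theorem eulerPow_ne_zero (hd : d ≠ 0) : eulerPow d ≠ 0 := by
  intro h
  simpa [h] using constantCoeff_eulerPow hd

/-! ### Gaussian binomial coefficients -/

/-- The inverse of `qPoch d k`, extended by zero to negative `k`. -/
def qPochInv (d : ℕ) (k : ℤ) : ℂ⟦X⟧ := if 0 ≤ k then (qPoch d k.toNat)⁻¹ else 0

theorem qPochInv_natCast (d k : ℕ) : qPochInv d k = (qPoch d k)⁻¹ := by simp [qPochInv]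

theorem qPochInv_of_neg (d : ℕ) {k : ℤ} (hk : k < 0) : qPochInv d k = 0 := by
  simp [qPochInv, hk]

theorem qPoch_mul_inv (hd : d ≠ 0) (k : ℕ) : qPoch d k * qPochInv d k = 1 := by
  rw [qPochInv_natCast]
  exact PowerSeries.mul_inv_cancel _ (by simp [constantCoeff_qPoch hd])

theorem qPochInv_sub_one (hd : d ≠ 0) (k : ℕ) :
    qPochInv d ((k : ℤ) - 1) = (1 - X ^ (d * k)) * qPochInv d k := by
  cases k with
  | zero => simp [qPochInv]
  | succ k =>
    have h1 := qPoch_mul_inv hd k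
    have h2 := qPoch_mul_inv hd (k + 1)
    rw [qPoch_succ] at h2
    have h3 : ((k + 1 : ℕ) : ℤ) - 1 = k := by push_cast; ring
    rw [h3]
    linear_combination (1 - X ^ (d * (k + 1))) * qPochInv d (k + 1 : ℕ) * h1 - qPochInv d k * h2

/-- The Gaussian binomial coefficient `[2N, N+n]` at `q^d`. -/
def gaussBinom (d N : ℕ) (n : ℤ) : ℂ⟦X⟧ :=
  qPoch d (2 * N) * qPochInv d (N - n) * qPochInv d (N + n)

theorem gaussBinom_of_lt {N : ℕ} {n : ℤ} (h : (N : ℤ) < |n|) : gaussBinom d N n = 0 := by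
  rw [gaussBinom]
  rcases lt_abs.mp h with h | h
  · rw [qPochInv_of_neg d (k := N - n) (by omega)]; simp
  · rw [qPochInv_of_neg d (k := N + n) (by omega)]; simp

theorem gaussBinom_zero_zero (hd : d ≠ 0) : gaussBinom d 0 0 = 1 := by
  have := qPoch_mul_inv hd 0
  rw [qPoch_zero, one_mul] at this
  simpa [gaussBinom, qPoch_zero] using by rw [show (0:ℤ) = ((0:ℕ):ℤ) from rfl, this]; simp

/-- Two steps of the q-Pascal rule at once. After factoring out the common inverse Pochhammer
symbols it becomes a polynomial identity in Q^M and Q^K, where M = N+1-n, K = N+1+n and M + K = 2N +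
2. -/
theorem gaussBinom_succ (hd : d ≠ 0) (N : ℕ) (n : ℤ) :
    gaussBinom d (N + 1) n = (1 + X ^ (d * (2 * N + 1))) * gaussBinom d N n
      + X ^ (d * (N + 1 - n).toNat) * gaussBinom d N (n - 1)
      + X ^ (d * (N + 1 + n).toNat) * gaussBinom d N (n + 1) := by
  rcases lt_or_ge ((N : ℤ) + 1) |n| with h | h
  · have h1 : (N : ℤ) < |n - 1| := by have := abs_sub_abs_le_abs_sub n 1; simp at this; omega
    have h2 : (N : ℤ) < |n + 1| := by have := abs_sub_abs_le_abs_sub n (-1); simp at this; omega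
    rw [gaussBinom_of_lt (by push_cast; omega), gaussBinom_of_lt h1, gaussBinom_of_lt h2,
      gaussBinom_of_lt (by omega)]
    simp
  · rw [abs_le] at h
    obtain ⟨M, hM⟩ := Int.eq_ofNat_of_zero_le (show 0 ≤ (N : ℤ) + 1 - n by omega)
    obtain ⟨K, hK⟩ := Int.eq_ofNat_of_zero_le (show 0 ≤ (N : ℤ) + 1 + n by omega)
    have hMK : M + K = 2 * N + 2 := by omega
    -- At k = 0 the truncated exponent k - 1 is harmless, because the other factor 1 - X^0 vanishes.
    have hpred : ∀ k : ℕ, qPochInv d ((k : ℤ) - 2) =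
        (1 - X ^ (d * k)) * (1 - X ^ (d * (k - 1))) * qPochInv d k := by
      intro k
      cases k with
      | zero => simp [qPochInv]
      | succ k =>
        have h1 := qPochInv_sub_one hd (k + 1)
        have h2 := qPochInv_sub_one hd k
        rw [show ((k + 1 : ℕ) : ℤ) - 1 = k by push_cast; ring] at h1
        rw [show ((k + 1 : ℕ) : ℤ) - 2 = k - 1 by push_cast; ring, h2, h1, Nat.add_sub_cancel]
        ring
    simp only [gaussBinom]
    rw [show ((N + 1 : ℕ) : ℤ) - n = M by push_cast; omega,
      show ((N + 1 : ℕ) : ℤ) + n = K by push_cast; omega,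
      show (N : ℤ) - n = M - 1 by omega, show (N : ℤ) + n = K - 1 by omega,
      show (N : ℤ) - (n - 1) = M by omega, show (N : ℤ) + (n - 1) = K - 2 by omega,
      show (N : ℤ) - (n + 1) = M - 2 by omega, show (N : ℤ) + (n + 1) = K by omega,
      hM, hK, qPochInv_sub_one hd, qPochInv_sub_one hd, hpred, hpred,
      show 2 * (N + 1) = 2 * N + 1 + 1 by ring, qPoch_succ, qPoch_succ]
    simp only [Int.toNat_natCast]
    have key : (1 - X ^ (d * (2 * N + 1))) * (1 - X ^ (d * (2 * N + 1 + 1))) =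
        (1 + X ^ (d * (2 * N + 1))) * ((1 - X ^ (d * M)) * (1 - X ^ (d * K)))
        + X ^ (d * M) * ((1 - X ^ (d * K)) * (1 - X ^ (d * (K - 1))))
        + X ^ (d * K) * ((1 - X ^ (d * M)) * (1 - X ^ (d * (M - 1))) : ℂ⟦X⟧) := by
      simp only [pow_mul]
      generalize (X ^ d : ℂ⟦X⟧) = Q
      rw [show 2 * N + 1 + 1 = M + K by omega]
      rcases M with _ | M
      · rcases K with _ | K
        · omega
        · rw [show 2 * N + 1 = K by omega, Nat.add_sub_cancel]; ring
      · rcases K with _ | K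
        · rw [show 2 * N + 1 = M by omega, Nat.add_sub_cancel]; ring
        · rw [show 2 * N + 1 = M + K + 1 by omega, Nat.add_sub_cancel, Nat.add_sub_cancel]; ring
    linear_combination (qPoch d (2 * N) * qPochInv d M * qPochInv d K) * key

theorem X_pow_dvd_eulerPow_mul_qPochInv_sub (hd : d ≠ 0) (k : ℕ) :
    X ^ k ∣ eulerPow d * qPochInv d k - 1 := by
  obtain ⟨r, hr⟩ := X_pow_dvd_eulerPow_sub hd k
  exact ⟨r * qPochInv d k, by linear_combination qPochInv d k * hr + qPoch_mul_inv hd k⟩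

/-- The Gaussian binomial tends to the inverse of the infinite product; the precision is governed by
the smaller of the indices N - n and N + n, both at least j. -/
theorem X_pow_dvd_eulerPow_mul_gaussBinom_sub (hd : d ≠ 0) {N : ℕ} {n : ℤ} {j : ℕ}
    (h : |n| + j ≤ N) : X ^ j ∣ eulerPow d * gaussBinom d N n - 1 := by
  have h' := abs_le.mp (show |n| ≤ (N : ℤ) - j by omega)
  obtain ⟨M, hM⟩ := Int.eq_ofNat_of_zero_le (show 0 ≤ (N : ℤ) - n by omega)
  obtain ⟨K, hK⟩ := Int.eq_ofNat_of_zero_le (show 0 ≤ (N : ℤ) + n by omega)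
  rw [gaussBinom, hM, hK]
  obtain ⟨r, hr⟩ := (pow_dvd_pow X (show j ≤ M by omega)).trans
    (X_pow_dvd_eulerPow_mul_qPochInv_sub hd M)
  obtain ⟨s, hs⟩ := (pow_dvd_pow X (show j ≤ K by omega)).trans
    (X_pow_dvd_qPoch_sub hd (show K ≤ 2 * N by omega))
  refine ⟨r * (qPoch d (2 * N) * qPochInv d K) + s * qPochInv d K, ?_⟩
  linear_combination qPoch d (2 * N) * qPochInv d K * hr + qPochInv d K * hs + qPoch_mul_inv hd K

end

noncomputable section

theorem hasSum_of_eq {ι : Type*} {f g : ι → ℂ⟦X⟧} {u v : ℂ⟦X⟧} (h : HasSum f u)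
    (hfg : ∀ i, g i = f i) (huv : v = u) : HasSum g v := by
  rw [funext hfg, huv]; exact h

/-! ### Theta series and the finite triple product -/

/-- The exponent of `q` in the `n`-th term of the theta series with base `q^d` at `x = c q^a`. -/
def thetaExp (d a : ℕ) (n : ℤ) : ℕ := (d * (n * (n - 1) / 2) + a * n).toNat

/-- The `n`-th term `(-1)^n Q^{n(n-1)/2} x^n` for `Q = q^d` and `x = c q^a`. -/
def thetaTerm (d a : ℕ) (c : ℂ) (n : ℤ) : ℂ⟦X⟧ := monomial (thetaExp d a n) ((-c) ^ n)

/-- The weighted theta series `∑ φ(n) (-1)^n Q^{n(n-1)/2} x^n`. -/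
def thetaSum (d a : ℕ) (c : ℂ) (φ : ℤ → ℂ) : ℂ⟦X⟧ := ∑' n, C (φ n) * thetaTerm d a c n

/-- The finite analogue of `thetaSum`, weighted by Gaussian binomial coefficients. -/
def thetaFin (d a : ℕ) (c : ℂ) (N : ℕ) (φ : ℤ → ℂ) : ℂ⟦X⟧ :=
  ∑' n, C (φ n) * (gaussBinom d N n * thetaTerm d a c n)

/-- For 0 ≤ a ≤ d the exponent is never negative, so `toNat` loses nothing; doubling removes the
integer division, making exponent comparisons linear arithmetic. -/
theorem two_mul_thetaExp {d a : ℕ} (h : a ≤ d) (n : ℤ) :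
    2 * (thetaExp d a n : ℤ) = d * (n * (n - 1)) + 2 * a * n := by
  obtain ⟨t, ht⟩ := (Int.even_mul_pred_self n).two_dvd
  have ha : (a : ℤ) ≤ d := by exact_mod_cast h
  have h0 : 0 ≤ (d * (n * (n - 1) / 2) + a * n : ℤ) := by
    rw [ht, Int.mul_ediv_cancel_left _ two_ne_zero]
    have h2 : 0 ≤ 2 * (d * t + a * n : ℤ) := by
      rw [show 2 * (d * t + a * n : ℤ) = d * (2 * t) + 2 * a * n by ring, ← ht]
      rcases le_or_gt n 0 with hn | hn
      · nlinarith [mul_nonneg (sub_nonneg.mpr ha) (neg_nonneg.mpr hn),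
          mul_nonneg (Int.natCast_nonneg d) (show 0 ≤ n * (n + 1) by
            rcases hn.lt_or_eq with h | h
            · nlinarith
            · simp [h])]
      · have : 0 ≤ n * (n - 1) := mul_nonneg hn.le (by omega)
        positivity
    omega
  rw [thetaExp, Int.toNat_of_nonneg h0, ht, Int.mul_ediv_cancel_left _ two_ne_zero]
  ring

theorem abs_le_thetaExp {d a : ℕ} (hd : d ≠ 0) (h : a ≤ d) (n : ℤ) :
    |n| ≤ thetaExp d a n + 1 := by
  have ha : (a : ℤ) ≤ d := by exact_mod_cast h
  have hd' : (1 : ℤ) ≤ d := by exact_mod_cast Nat.one_le_iff_ne_zero.mpr hd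
  have h2 := two_mul_thetaExp h n
  have ha0 : (0 : ℤ) ≤ a := Int.natCast_nonneg a
  rcases le_or_gt n 0 with hn | hn
  · rw [abs_of_nonpos hn]
    have h3 : (d : ℤ) * (n * (n + 1)) ≤ 2 * thetaExp d a n := by
      nlinarith [mul_nonneg (sub_nonneg.mpr ha) (neg_nonneg.mpr hn)]
    have h4 : 0 ≤ n * (n + 1) := by
      rcases hn.lt_or_eq with h | h
      · nlinarith
      · simp [h]
    nlinarith [mul_nonneg (sub_nonneg.mpr hd') h4, sq_nonneg (n + 1), sq_nonneg (2 * n + 3)]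
  · rw [abs_of_pos hn]
    have h4 : 0 ≤ n * (n - 1) := mul_nonneg hn.le (by omega)
    nlinarith [mul_nonneg (sub_nonneg.mpr hd') h4, mul_nonneg ha0 hn.le, sq_nonneg (n - 1),
      sq_nonneg (2 * n - 3)]

variable {d a : ℕ} {c : ℂ}

theorem summable_thetaTerm (hd : d ≠ 0) (ha : a ≤ d) (φ : ℤ → ℂ) :
    Summable fun n => C (φ n) * thetaTerm d a c n := by
  refine summable_of_finite_coeff fun k => (Set.finite_Icc (-(k + 1) : ℤ) (k + 1)).subset ?_
  intro n hn
  have h := abs_le_thetaExp hd ha n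
  have hk : k = thetaExp d a n := by
    by_contra hk
    simp [thetaTerm, coeff_monomial, hk] at hn
  rw [← hk, abs_le] at h
  exact h

theorem hasSum_thetaSum (hd : d ≠ 0) (ha : a ≤ d) (φ : ℤ → ℂ) :
    HasSum (fun n => C (φ n) * thetaTerm d a c n) (thetaSum d a c φ) :=
  (summable_thetaTerm hd ha φ).hasSum

theorem hasSum_thetaFin (N : ℕ) (φ : ℤ → ℂ) :
    HasSum (fun n => C (φ n) * (gaussBinom d N n * thetaTerm d a c n)) (thetaFin d a c N φ) := by
  refine (summable_of_hasFiniteSupport ?_).hasSum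
  refine (Set.finite_Icc (-N : ℤ) N).subset fun n hn => ?_
  rw [Set.mem_Icc, ← abs_le]
  by_contra h
  simp [gaussBinom_of_lt (not_le.mp h)] at hn

/-- Consecutive terms have ratio -xQ^n, so the factor Q^{N-n} cancels the dependence on n. This is
what turns the Gaussian recurrence into a plain shift of the weight φ. -/
theorem thetaTerm_succ (ha : a ≤ d) (hc : c ≠ 0) {N : ℕ} {n : ℤ} (h : |n| ≤ N) :
    X ^ (d * (N - n).toNat) * thetaTerm d a c (n + 1) =
      -(monomial a c * X ^ (d * N) * thetaTerm d a c n) := by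
  obtain ⟨h1, h2⟩ := abs_le.mp h
  simp only [thetaTerm, X_pow_eq, monomial_mul_monomial, ← map_neg]
  congr 2
  · zify
    rw [Int.toNat_of_nonneg (by omega)]
    refine mul_left_cancel₀ (two_ne_zero (α := ℤ)) ?_
    linear_combination two_mul_thetaExp ha (n + 1) - two_mul_thetaExp ha n
  · rw [zpow_add_one₀ (neg_ne_zero.mpr hc)]; ring

theorem thetaTerm_pred (ha : a ≤ d) (hc : c ≠ 0) {N : ℕ} {n : ℤ} (h : |n| ≤ N) :
    X ^ (d * (N + n).toNat) * thetaTerm d a c (n - 1) =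
      -(monomial (d - a) c⁻¹ * X ^ (d * N) * thetaTerm d a c n) := by
  obtain ⟨h1, h2⟩ := abs_le.mp h
  simp only [thetaTerm, X_pow_eq, monomial_mul_monomial, ← map_neg]
  congr 2
  · zify [ha]
    rw [Int.toNat_of_nonneg (by omega)]
    refine mul_left_cancel₀ (two_ne_zero (α := ℤ)) ?_
    linear_combination two_mul_thetaExp ha (n - 1) - two_mul_thetaExp ha n
  · rw [zpow_sub_one₀ (neg_ne_zero.mpr hc), inv_neg]; ring

/-- For φ = 1 this is the step of the finite Jacobi triple product, with new factor (1 - xQ^N)(1 -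
Q^{N+1}/x). The weights n and n² play the role of the first and second derivatives under x d/dx, so
no differentiation in x is needed. -/
theorem thetaFin_succ (hd : d ≠ 0) (ha : a ≤ d) (hc : c ≠ 0) (N : ℕ) (φ : ℤ → ℂ) :
    thetaFin d a c (N + 1) φ = (1 + X ^ (d * (2 * N + 1))) * thetaFin d a c N φ
      - monomial a c * X ^ (d * N) * thetaFin d a c N (fun n => φ (n + 1))
      - monomial (d - a) c⁻¹ * X ^ (d * N) * thetaFin d a c N (fun n => φ (n - 1)) := by
  have h0 := (hasSum_thetaFin (d := d) (a := a) (c := c) N φ).mul_left (1 + X ^ (d * (2 * N + 1)))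
  have h1 := (hasSum_thetaFin (d := d) (a := a) (c := c) N
    fun n => φ (n + 1)).mul_left (-(monomial a c * X ^ (d * N)))
  have h2 := (hasSum_thetaFin (d := d) (a := a) (c := c) N
    fun n => φ (n - 1)).mul_left (-(monomial (d - a) c⁻¹ * X ^ (d * N)))
  rw [← (Equiv.subRight (1 : ℤ)).hasSum_iff] at h1
  rw [← (Equiv.addRight (1 : ℤ)).hasSum_iff] at h2
  have h := (h0.add h1).add h2
  refine (hasSum_thetaFin (N + 1) φ).unique ?_
  refine hasSum_of_eq h (fun n => ?_) ?_
  · simp only [Function.comp_apply, Equiv.subRight_apply, Equiv.coe_addRight, sub_add_cancel,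
      add_sub_cancel_right]
    have e1 : -(monomial a c * X ^ (d * N)) * (C (φ n) * (gaussBinom d N (n - 1) *
        thetaTerm d a c (n - 1))) = C (φ n) * (X ^ (d * (N + 1 - n).toNat) *
          gaussBinom d N (n - 1) * thetaTerm d a c n) := by
      rcases lt_or_ge (N : ℤ) |n - 1| with h | h
      · simp [gaussBinom_of_lt h]
      · have := thetaTerm_succ ha hc h
        rw [sub_add_cancel, show (N : ℤ) - (n - 1) = N + 1 - n by ring] at this
        linear_combination -(C (φ n) * gaussBinom d N (n - 1)) * this
    have e2 : -(monomial (d - a) c⁻¹ * X ^ (d * N)) * (C (φ n) * (gaussBinom d N (n + 1) *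
        thetaTerm d a c (n + 1))) = C (φ n) * (X ^ (d * (N + 1 + n).toNat) *
          gaussBinom d N (n + 1) * thetaTerm d a c n) := by
      rcases lt_or_ge (N : ℤ) |n + 1| with h | h
      · simp [gaussBinom_of_lt h]
      · have := thetaTerm_pred ha hc h
        rw [add_sub_cancel_right, show (N : ℤ) + (n + 1) = N + 1 + n by ring] at this
        linear_combination -(C (φ n) * gaussBinom d N (n + 1)) * this
    rw [e1, e2, gaussBinom_succ hd]
    ring
  · ring

theorem thetaFin_zero (hd : d ≠ 0) (φ : ℤ → ℂ) : thetaFin d a c 0 φ = C (φ 0) := by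
  refine (hasSum_thetaFin 0 φ).unique ?_
  convert hasSum_single (0 : ℤ) ?_ using 1
  · simp [gaussBinom_zero_zero hd, thetaTerm, thetaExp]
  · intro n hn
    rw [gaussBinom_of_lt (by simpa using hn)]
    simp

theorem thetaFin_add (N : ℕ) (φ ψ : ℤ → ℂ) :
    thetaFin d a c N (fun n => φ n + ψ n) = thetaFin d a c N φ + thetaFin d a c N ψ := by
  refine (hasSum_thetaFin N _).unique ?_
  refine hasSum_of_eq ((hasSum_thetaFin N φ).add (hasSum_thetaFin N ψ)) (fun n => ?_) rfl
  rw [map_add]; ring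

theorem thetaFin_const_mul (N : ℕ) (r : ℂ) (φ : ℤ → ℂ) :
    thetaFin d a c N (fun n => r * φ n) = C r * thetaFin d a c N φ := by
  refine (hasSum_thetaFin N _).unique ?_
  refine hasSum_of_eq ((hasSum_thetaFin N φ).mul_left (C r)) (fun n => ?_) rfl
  rw [map_mul]; ring

theorem X_pow_dvd_thetaTerm (hd : d ≠ 0) (ha : a ≤ d) {n : ℤ} {j : ℕ} (h : (j : ℤ) + 1 ≤ |n|) :
    X ^ j ∣ thetaTerm d a c n := by
  have := abs_le_thetaExp hd ha n
  rw [thetaTerm, monomial_eq_C_mul_X_pow]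
  exact Dvd.dvd.mul_left (pow_dvd_pow X (by omega)) _

theorem tendsto_eulerPow_mul_thetaFin (hd : d ≠ 0) (ha : a ≤ d) (φ : ℤ → ℂ) :
    Tendsto (fun N => eulerPow d * thetaFin d a c N φ) atTop (𝓝 (thetaSum d a c φ)) := by
  rw [← tendsto_add_atTop_iff_nat 1]
  refine tendsto_of_X_pow_dvd fun N => ?_
  have h := ((hasSum_thetaFin (d := d) (a := a) (c := c) (N + 1) φ).mul_left (eulerPow d)).sub
    (hasSum_thetaSum (c := c) hd ha φ)
  rw [X_pow_dvd_iff]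
  intro m hm
  refine ((WithPiTopology.hasSum_iff_hasSum_coeff (R := ℂ)).mp h m).unique ?_
  convert hasSum_zero using 1
  funext n
  have e : eulerPow d * (C (φ n) * (gaussBinom d (N + 1) n * thetaTerm d a c n)) -
      C (φ n) * thetaTerm d a c n =
      C (φ n) * ((eulerPow d * gaussBinom d (N + 1) n - 1) * thetaTerm d a c n) := by ring
  rw [e]
  refine X_pow_dvd_iff.mp (Dvd.dvd.mul_left ?_ _) m hm
  rcases lt_or_ge ((N : ℤ) + 1) |n| with h' | h'
  · exact Dvd.dvd.mul_left (X_pow_dvd_thetaTerm hd ha (by omega)) _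
  · rcases eq_or_ne n 0 with rfl | h0
    · exact Dvd.dvd.mul_right (X_pow_dvd_eulerPow_mul_gaussBinom_sub hd (by simp)) _
    · have h1 := abs_pos.mpr h0
      obtain ⟨j, hj⟩ := Int.eq_ofNat_of_zero_le (show 0 ≤ (N : ℤ) + 1 - |n| by omega)
      obtain ⟨k, hk⟩ := Int.eq_ofNat_of_zero_le (show 0 ≤ |n| - 1 by omega)
      -- The binomial error has order at least N + 1 - |n| and the theta term order at least |n| -
      -- 1; the sum N does not depend on n.
      rw [show N = j + k by omega, pow_add]
      exact mul_dvd_mul (X_pow_dvd_eulerPow_mul_gaussBinom_sub hd (by push_cast; omega))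
        (X_pow_dvd_thetaTerm hd ha (by omega))

end

noncomputable section

/-! ### Logarithmic derivatives of theta series -/

/-- The rational function `y / (1 - y)^2`. -/
def koebe (y : ℂ⟦X⟧) : ℂ⟦X⟧ := y * (1 - y)⁻¹ ^ 2

theorem koebe_mul_sq {y : ℂ⟦X⟧} (hy : constantCoeff y ≠ 1) : koebe y * (1 - y) ^ 2 = y := by
  have h : (1 - y) * (1 - y)⁻¹ = 1 :=
    PowerSeries.mul_inv_cancel _ (by simpa [sub_eq_zero] using hy.symm)
  rw [koebe]
  linear_combination y * ((1 - y) * (1 - y)⁻¹ + 1) * h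

/-- The summand of `wpSum`. -/
def wpTerm (d a : ℕ) (c : ℂ) (i : ℕ) : ℂ⟦X⟧ :=
  koebe (monomial a c * X ^ (d * i)) + koebe (monomial (d - a) c⁻¹ * X ^ (d * i))

/-- The series `∑_{i ∈ ℤ} x Q^i / (1 - x Q^i)^2` for `Q = q^d`, `x = c q^a`; up to an additive
constant this is a Weierstrass function. -/
def wpSum (d a : ℕ) (c : ℂ) : ℂ⟦X⟧ := ∑' i, wpTerm d a c i

variable {d a : ℕ} {c : ℂ}

theorem hasSum_wpTerm (hd : d ≠ 0) : HasSum (wpTerm d a c) (wpSum d a c) := by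
  refine (summable_of_X_pow_dvd fun n => ?_).hasSum
  have h : (X : ℂ⟦X⟧) ^ n ∣ X ^ (d * n) :=
    pow_dvd_pow _ (Nat.le_mul_of_pos_left _ (Nat.pos_of_ne_zero hd))
  exact dvd_add ((h.mul_left _).mul_right _) ((h.mul_left _).mul_right _)

theorem monomial_mul_monomial_inv (ha : a ≤ d) (hc : c ≠ 0) :
    monomial a c * monomial (d - a) c⁻¹ = (X ^ d : ℂ⟦X⟧) := by
  rw [monomial_mul_monomial, mul_inv_cancel₀ hc, Nat.add_sub_cancel' ha, X_pow_eq]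

theorem thetaFin_one_succ (hd : d ≠ 0) (ha : a ≤ d) (hc : c ≠ 0) (N : ℕ) :
    thetaFin d a c (N + 1) (fun _ => 1) = (1 - monomial a c * X ^ (d * N)) *
      (1 - monomial (d - a) c⁻¹ * X ^ (d * N)) * thetaFin d a c N (fun _ => 1) := by
  rw [thetaFin_succ hd ha hc, show d * (2 * N + 1) = d + (d * N + d * N) by ring, pow_add, pow_add,
    ← monomial_mul_monomial_inv ha hc]
  ring

theorem thetaFin_id_succ (hd : d ≠ 0) (ha : a ≤ d) (hc : c ≠ 0) (N : ℕ) :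
    thetaFin d a c (N + 1) (fun n => n) = (1 - monomial a c * X ^ (d * N)) *
      (1 - monomial (d - a) c⁻¹ * X ^ (d * N)) * thetaFin d a c N (fun n => n) +
      (monomial (d - a) c⁻¹ - monomial a c) * X ^ (d * N) * thetaFin d a c N (fun _ => 1) := by
  have h1 : thetaFin d a c N (fun n => ((n + 1 : ℤ) : ℂ)) =
      thetaFin d a c N (fun n => n) + thetaFin d a c N (fun _ => 1) := by
    rw [← thetaFin_add]; simp
  have h2 : thetaFin d a c N (fun n => ((n - 1 : ℤ) : ℂ)) =
      thetaFin d a c N (fun n => n) + C (-1) * thetaFin d a c N (fun _ => 1) := by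
    rw [← thetaFin_const_mul, ← thetaFin_add]; simp [sub_eq_add_neg]
  rw [thetaFin_succ hd ha hc, h1, h2, show d * (2 * N + 1) = d + (d * N + d * N) by ring, pow_add,
    pow_add, ← monomial_mul_monomial_inv ha hc, map_neg, map_one]
  ring

theorem thetaFin_sq_succ (hd : d ≠ 0) (ha : a ≤ d) (hc : c ≠ 0) (N : ℕ) :
    thetaFin d a c (N + 1) (fun n => n ^ 2) = (1 - monomial a c * X ^ (d * N)) *
      (1 - monomial (d - a) c⁻¹ * X ^ (d * N)) * thetaFin d a c N (fun n => n ^ 2) +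
      2 * (monomial (d - a) c⁻¹ - monomial a c) * X ^ (d * N) * thetaFin d a c N (fun n => n) -
      (monomial (d - a) c⁻¹ + monomial a c) * X ^ (d * N) * thetaFin d a c N (fun _ => 1) := by
  have h1 : thetaFin d a c N (fun n => ((n + 1 : ℤ) : ℂ) ^ 2) = thetaFin d a c N (fun n => n ^ 2) +
      C 2 * thetaFin d a c N (fun n => n) + thetaFin d a c N (fun _ => 1) := by
    rw [← thetaFin_const_mul, ← thetaFin_add, ← thetaFin_add]
    congr 1; funext n; push_cast; ring
  have h2 : thetaFin d a c N (fun n => ((n - 1 : ℤ) : ℂ) ^ 2) = thetaFin d a c N (fun n => n ^ 2) +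
      C (-2) * thetaFin d a c N (fun n => n) + thetaFin d a c N (fun _ => 1) := by
    rw [← thetaFin_const_mul, ← thetaFin_add, ← thetaFin_add]
    congr 1; funext n; push_cast; ring
  rw [thetaFin_succ hd ha hc, h1, h2, show d * (2 * N + 1) = d + (d * N + d * N) by ring, pow_add,
    pow_add, ← monomial_mul_monomial_inv ha hc, map_neg, map_ofNat]
  ring

theorem constantCoeff_ne_one (hac : a ≠ 0 ∨ c ≠ 1) (i : ℕ) :
    constantCoeff (monomial a c * X ^ (d * i)) ≠ 1 := by
  rw [X_pow_eq, monomial_mul_monomial, ← coeff_zero_eq_constantCoeff_apply, coeff_monomial]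
  rcases hac with h | h
  · rw [if_neg (by omega)]
    exact zero_ne_one
  · split_ifs <;> simp [h]

/-- With D = x d/dx, the left side is f² D² log f. Each new factor 1 - y with y = xQ^i or y =
Q^{i+1}/x contributes D² log(1 - y) = -y/(1 - y)². The hypotheses keep every 1 - y invertible. -/
theorem thetaFin_logDeriv (hd : d ≠ 0) (ha : a < d) (hc : c ≠ 0) (hac : a ≠ 0 ∨ c ≠ 1) (N : ℕ) :
    thetaFin d a c N (fun _ => 1) * thetaFin d a c N (fun n => n ^ 2) -
      thetaFin d a c N (fun n => n) ^ 2 =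
      -(thetaFin d a c N (fun _ => 1) ^ 2 * ∑ i ∈ range N, wpTerm d a c i) := by
  induction N with
  | zero => simp [thetaFin_zero hd]
  | succ N ih =>
    have hx := koebe_mul_sq (constantCoeff_ne_one (d := d) hac N)
    have hz := koebe_mul_sq (constantCoeff_ne_one (d := d) (a := d - a) (c := c⁻¹)
      (Or.inl (by omega)) N)
    rw [thetaFin_one_succ hd ha.le hc, thetaFin_id_succ hd ha.le hc, thetaFin_sq_succ hd ha.le hc,
      sum_range_succ, wpTerm]
    generalize koebe (monomial a c * X ^ (d * N)) = jx at *
    generalize koebe (monomial (d - a) c⁻¹ * X ^ (d * N)) = jz at *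
    generalize thetaFin d a c N (fun _ => 1) = f at *
    generalize thetaFin d a c N (fun n => (n : ℂ)) = g at *
    generalize thetaFin d a c N (fun n => (n : ℂ) ^ 2) = h at *
    generalize (monomial a c : ℂ⟦X⟧) = x at *
    generalize (monomial (d - a) c⁻¹ : ℂ⟦X⟧) = z at *
    generalize (X ^ (d * N) : ℂ⟦X⟧) = Q at *
    linear_combination ((1 - x * Q) * (1 - z * Q)) ^ 2 * ih + f ^ 2 * (1 - z * Q) ^ 2 * hx +
      f ^ 2 * (1 - x * Q) ^ 2 * hz

theorem thetaSum_logDeriv (hd : d ≠ 0) (ha : a < d) (hc : c ≠ 0) (hac : a ≠ 0 ∨ c ≠ 1) :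
    thetaSum d a c (fun _ => 1) * thetaSum d a c (fun n => n ^ 2) -
      thetaSum d a c (fun n => n) ^ 2 = -(thetaSum d a c (fun _ => 1) ^ 2 * wpSum d a c) := by
  have t := fun φ => tendsto_eulerPow_mul_thetaFin (c := c) hd ha.le φ
  have h1 := ((t fun _ => 1).mul (t fun n => n ^ 2)).sub ((t fun n => n).pow 2)
  have h2 := (((t fun _ => 1).pow 2).mul (hasSum_wpTerm (a := a) (c := c) hd).tendsto_sum_nat).neg
  refine tendsto_nhds_unique h1 (h2.congr fun N => ?_)
  linear_combination -eulerPow d ^ 2 * thetaFin_logDeriv hd ha hc hac N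

theorem thetaFin_one_one (hd : d ≠ 0) (N : ℕ) : thetaFin d 0 1 (N + 1) (fun _ => 1) = 0 := by
  induction N with
  | zero => simp [thetaFin_one_succ hd]
  | succ N ih => rw [thetaFin_one_succ hd (Nat.zero_le _) one_ne_zero, ih, mul_zero]

theorem thetaSum_one_one (hd : d ≠ 0) : thetaSum d 0 1 (fun _ => 1) = 0 := by
  refine tendsto_nhds_unique
    ((tendsto_add_atTop_iff_nat 1).mpr (tendsto_eulerPow_mul_thetaFin hd (Nat.zero_le _) _)) ?_
  simp [thetaFin_one_one hd]

/-- At x = 1 the factor 1 - x vanishes, so the derivative of the product is -1 times the remaining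
factors. In the limit this is Jacobi's formula for the cube of the Euler product. -/
theorem thetaFin_one_id (hd : d ≠ 0) (N : ℕ) :
    thetaFin d 0 1 (N + 1) (fun n => n) = -(qPoch d N * qPoch d (N + 1)) := by
  induction N with
  | zero =>
    rw [thetaFin_id_succ hd (Nat.zero_le _) one_ne_zero, thetaFin_zero hd, thetaFin_zero hd,
      qPoch_succ, qPoch_zero]
    simp [← X_pow_eq]
  | succ N ih =>
    rw [thetaFin_id_succ hd (Nat.zero_le _) one_ne_zero, ih, thetaFin_one_one hd,
      qPoch_succ d (N + 1),
      qPoch_succ d N, inv_one, Nat.sub_zero, ← X_pow_eq, ← X_pow_eq]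
    ring

theorem thetaSum_one_id (hd : d ≠ 0) : thetaSum d 0 1 (fun n => n) = -eulerPow d ^ 3 := by
  refine tendsto_nhds_unique
    ((tendsto_add_atTop_iff_nat 1).mpr (tendsto_eulerPow_mul_thetaFin hd (Nat.zero_le _) _)) ?_
  have h := tendsto_qPoch hd
  have h2 := ((h.mul ((tendsto_add_atTop_iff_nat 1).mpr h)).neg).const_mul (eulerPow d)
  rw [show -eulerPow d ^ 3 = eulerPow d * -(eulerPow d * eulerPow d) by ring]
  exact h2.congr fun N => by rw [thetaFin_one_id hd]

end

noncomputable section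

/-! ### The addition formula for theta series -/

/-- A family of power series indexed by `ℤ` whose orders grow at least linearly. -/
def LinearOrderGrowth (f : ℤ → ℂ⟦X⟧) : Prop :=
  ∀ (n : ℤ) (j : ℕ), (j : ℤ) + 1 ≤ |n| → X ^ j ∣ f n

theorem LinearOrderGrowth.const_mul {f : ℤ → ℂ⟦X⟧} (hf : LinearOrderGrowth f) (g : ℤ → ℂ⟦X⟧) :
    LinearOrderGrowth fun n => g n * f n :=
  fun n j h => (hf n j h).mul_left _

theorem LinearOrderGrowth.summable_mul {f g : ℤ → ℂ⟦X⟧} (hf : LinearOrderGrowth f)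
    (hg : LinearOrderGrowth g) (φ : ℤ × ℤ → ℂ⟦X⟧) :
    Summable fun p : ℤ × ℤ => φ p * (f p.1 * g p.2) := by
  refine summable_of_finite_coeff fun k => Set.Finite.subset
    ((Set.finite_Icc (-(k + 1) : ℤ) (k + 1)).prod (Set.finite_Icc (-(k + 1) : ℤ) (k + 1))) ?_
  intro p hp
  rw [Set.mem_prod, Set.mem_Icc, Set.mem_Icc, ← abs_le, ← abs_le]
  constructor
  · by_contra h
    exact hp (X_pow_dvd_iff.mp (((hf p.1 (k + 1) (by push_cast; omega)).mul_right _).mul_left _) k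
      (by omega))
  · by_contra h
    exact hp (X_pow_dvd_iff.mp (((hg p.2 (k + 1) (by push_cast; omega)).mul_left _).mul_left _) k
      (by omega))

theorem LinearOrderGrowth.summable {f : ℤ → ℂ⟦X⟧} (hf : LinearOrderGrowth f) : Summable f := by
  refine summable_of_finite_coeff fun k => (Set.finite_Icc (-(k + 1) : ℤ) (k + 1)).subset ?_
  intro n hn
  rw [Set.mem_Icc, ← abs_le]
  by_contra h
  exact hn (X_pow_dvd_iff.mp (hf n (k + 1) (by push_cast; omega)) k (by omega))

theorem LinearOrderGrowth.hasSum_mul {f g : ℤ → ℂ⟦X⟧} (hf : LinearOrderGrowth f)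
    (hg : LinearOrderGrowth g) :
    HasSum (fun p : ℤ × ℤ => f p.1 * g p.2) ((∑' n, f n) * ∑' n, g n) :=
  hf.summable.hasSum.mul hg.summable.hasSum (by simpa using hf.summable_mul hg fun _ => 1)

/-- The two substitutions parametrise the pairs with even and with odd coordinate sum. -/
theorem hasSum_parity_split {f : ℤ × ℤ → ℂ⟦X⟧} {u v : ℂ⟦X⟧}
    (he : HasSum (fun p : ℤ × ℤ => f (p.1 + p.2, p.1 - p.2)) u)
    (ho : HasSum (fun p : ℤ × ℤ => f (p.1 + p.2 + 1, p.1 - p.2)) v) : HasSum f (u + v) := by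
  have he' : Function.Injective fun p : ℤ × ℤ => (p.1 + p.2, p.1 - p.2) := by
    rintro ⟨a, b⟩ ⟨c, d⟩ h
    simp only [Prod.mk.injEq] at h ⊢
    omega
  have ho' : Function.Injective fun p : ℤ × ℤ => (p.1 + p.2 + 1, p.1 - p.2) := by
    rintro ⟨a, b⟩ ⟨c, d⟩ h
    simp only [Prod.mk.injEq] at h ⊢
    omega
  refine HasSum.add_isCompl (s := Set.range fun p : ℤ × ℤ => (p.1 + p.2, p.1 - p.2))
    (t := Set.range fun p : ℤ × ℤ => (p.1 + p.2 + 1, p.1 - p.2)) ?_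
    (he'.hasSum_range_iff.mpr he) (ho'.hasSum_range_iff.mpr ho)
  refine ⟨Set.disjoint_left.mpr ?_, codisjoint_iff.mpr (Set.eq_univ_of_forall ?_)⟩
  · rintro _ ⟨p, rfl⟩ ⟨q, hq⟩
    simp only [Prod.mk.injEq] at hq
    omega
  · rintro ⟨m, n⟩
    rcases Int.even_or_odd' (m + n) with ⟨k, hk | hk⟩
    · exact Or.inl ⟨(k, m - k), by simp only [Prod.mk.injEq]; omega⟩
    · exact Or.inr ⟨(k, m - k - 1), by simp only [Prod.mk.injEq]; omega⟩

/-- The even part `Q^{s^2 - s} x^{2s}` for `Q = q^d`, `x = c q^a`. -/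
def evenTerm (d a : ℕ) (c : ℂ) (s : ℤ) : ℂ⟦X⟧ :=
  monomial (d * (s ^ 2 - s) + 2 * a * s).toNat (c ^ (2 * s))

/-- The odd part `Q^{s^2} x^{2s+1}` for `Q = q^d`, `x = c q^a`. -/
def oddTerm (d a : ℕ) (c : ℂ) (s : ℤ) : ℂ⟦X⟧ :=
  monomial (d * s ^ 2 + a * (2 * s + 1)).toNat (c ^ (2 * s + 1))

variable {d a b : ℕ} {c e : ℂ}

theorem le_evenExp (hd : d ≠ 0) (ha : a ≤ d) (s : ℤ) :
    |s| - 1 ≤ d * (s ^ 2 - s) + 2 * a * s ∧ 0 ≤ d * (s ^ 2 - s) + 2 * a * s := by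
  have ha' : (a : ℤ) ≤ d := by exact_mod_cast ha
  have hd' : (1 : ℤ) ≤ d := by exact_mod_cast Nat.one_le_iff_ne_zero.mpr hd
  have ha0 : (0 : ℤ) ≤ a := Int.natCast_nonneg a
  rcases le_or_gt s 0 with hs | hs
  · rw [abs_of_nonpos hs]
    have h4 : 0 ≤ s * (s + 1) := by
      rcases hs.lt_or_eq with h | h
      · nlinarith
      · simp [h]
    have h5 := mul_nonneg (sub_nonneg.mpr ha') (neg_nonneg.mpr hs)
    have h6 := mul_nonneg (sub_nonneg.mpr hd') h4
    constructor <;> nlinarith [sq_nonneg (s + 1)]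
  · rw [abs_of_pos hs]
    have h4 : 0 ≤ s * (s - 1) := mul_nonneg hs.le (by omega)
    have h5 := mul_nonneg ha0 hs.le
    have h6 := mul_nonneg (sub_nonneg.mpr hd') h4
    constructor <;> nlinarith [sq_nonneg (s - 1)]

theorem le_oddExp (hd : d ≠ 0) (ha : a ≤ d) (s : ℤ) :
    |s| - 1 ≤ d * s ^ 2 + a * (2 * s + 1) ∧ 0 ≤ d * s ^ 2 + a * (2 * s + 1) := by
  have ha' : (a : ℤ) ≤ d := by exact_mod_cast ha
  have hd' : (1 : ℤ) ≤ d := by exact_mod_cast Nat.one_le_iff_ne_zero.mpr hd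
  have ha0 : (0 : ℤ) ≤ a := Int.natCast_nonneg a
  rcases lt_or_ge s 0 with hs | hs
  · rw [abs_of_neg hs]
    have h5 := mul_nonneg (sub_nonneg.mpr ha') (show 0 ≤ -(2 * s + 1) by omega)
    have h6 := mul_nonneg (sub_nonneg.mpr hd') (sq_nonneg (s + 1))
    have h7 : 0 ≤ (s + 1) * (s + 2) := by
      rcases (show s ≤ -2 ∨ s = -1 by omega) with h | h
      · nlinarith
      · simp [h]
    constructor <;> nlinarith
  · rw [abs_of_nonneg hs]
    have h5 := mul_nonneg ha0 (show 0 ≤ 2 * s + 1 by omega)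
    have h6 := mul_nonneg (sub_nonneg.mpr hd') (sq_nonneg s)
    constructor <;> nlinarith [sq_nonneg (s - 1)]

theorem linearOrderGrowth_monomial {f : ℤ → ℤ} (hf : ∀ s, |s| - 1 ≤ f s) (g : ℤ → ℂ) :
    LinearOrderGrowth fun s => monomial (f s).toNat (g s) := by
  intro s j hj
  have := hf s
  beta_reduce
  rw [monomial_eq_C_mul_X_pow]
  exact Dvd.dvd.mul_left (pow_dvd_pow X (by omega)) _

theorem linearOrderGrowth_evenTerm (hd : d ≠ 0) (ha : a ≤ d) :
    LinearOrderGrowth (evenTerm d a c) :=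
  linearOrderGrowth_monomial (fun s => (le_evenExp hd ha s).1) _

theorem linearOrderGrowth_oddTerm (hd : d ≠ 0) (ha : a ≤ d) :
    LinearOrderGrowth (oddTerm d a c) :=
  linearOrderGrowth_monomial (fun s => (le_oddExp hd ha s).1) _

theorem linearOrderGrowth_thetaTerm (hd : d ≠ 0) (ha : a ≤ d) :
    LinearOrderGrowth (thetaTerm d a c) :=
  fun _ _ h => X_pow_dvd_thetaTerm hd ha h

theorem zpow_mul_zpow_neg (hc : c ≠ 0) (he : e ≠ 0) (m n : ℤ) :
    (-(c * e)) ^ m * (-(c * e⁻¹)) ^ n = (-1) ^ (m + n) * c ^ (m + n) * e ^ (m - n) := by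
  rw [neg_eq_neg_one_mul (c * e), neg_eq_neg_one_mul (c * e⁻¹)]
  simp only [mul_zpow, inv_zpow, zpow_add₀ hc, zpow_add₀ (neg_ne_zero.mpr (one_ne_zero (α := ℂ))),
    zpow_sub₀ he]
  field_simp

/-- With m = s + r and n = s - r the quadratic exponents decouple into s² - s and r². The extra
factor y = e q^b makes the power of y odd, so that x and y enter through the same two families of
terms. -/
theorem monomial_mul_thetaTerm_even (hd : d ≠ 0) (hba : b ≤ a) (hab : a + b ≤ d) (hc : c ≠ 0)
    (he : e ≠ 0) (s r : ℤ) :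
    monomial b e * (thetaTerm d (a + b) (c * e) (s + r) * thetaTerm d (a - b) (c * e⁻¹) (s - r)) =
      evenTerm d a c s * oddTerm d b e r := by
  simp only [thetaTerm, evenTerm, oddTerm, monomial_mul_monomial]
  refine congrArg₂ (fun k z => monomial k z) ?_ ?_
  · zify
    rw [Int.toNat_of_nonneg (le_evenExp hd (by omega) s).2,
      Int.toNat_of_nonneg (le_oddExp hd (by omega) r).2]
    have h1 := two_mul_thetaExp hab (s + r)
    have h2 := two_mul_thetaExp (show a - b ≤ d by omega) (s - r)
    push_cast [hba] at h1 h2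
    refine mul_left_cancel₀ (two_ne_zero (α := ℤ)) ?_
    linear_combination h1 + h2
  · rw [zpow_mul_zpow_neg hc he, show s + r + (s - r) = 2 * s by ring,
      show s + r - (s - r) = 2 * r by ring, zpow_add_one₀ he, (even_two_mul s).neg_one_zpow]
    ring

theorem monomial_mul_thetaTerm_odd (hd : d ≠ 0) (hba : b ≤ a) (hab : a + b ≤ d) (hc : c ≠ 0)
    (he : e ≠ 0) (s r : ℤ) :
    monomial b e *
        (thetaTerm d (a + b) (c * e) (s + r + 1) * thetaTerm d (a - b) (c * e⁻¹) (s - r)) =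
      -(oddTerm d a c s * evenTerm d b e (r + 1)) := by
  simp only [thetaTerm, evenTerm, oddTerm, monomial_mul_monomial, ← map_neg]
  refine congrArg₂ (fun k z => monomial k z) ?_ ?_
  · zify
    rw [Int.toNat_of_nonneg (le_evenExp hd (by omega) (r + 1)).2,
      Int.toNat_of_nonneg (le_oddExp hd (by omega) s).2]
    have h1 := two_mul_thetaExp hab (s + r + 1)
    have h2 := two_mul_thetaExp (show a - b ≤ d by omega) (s - r)
    push_cast [hba] at h1 h2
    refine mul_left_cancel₀ (two_ne_zero (α := ℤ)) ?_
    linear_combination h1 + h2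
  · rw [zpow_mul_zpow_neg hc he, show s + r + 1 + (s - r) = 2 * s + 1 by ring,
      show s + r + 1 - (s - r) = 2 * r + 1 by ring, show 2 * (r + 1) = 2 * r + 1 + 1 by ring,
      zpow_add_one₀ he (2 * r + 1), (odd_two_mul_add_one s).neg_one_zpow]
    ring

/-- The even part of a theta series. -/
def evenSum (d a : ℕ) (c : ℂ) : ℂ⟦X⟧ := ∑' s, evenTerm d a c s

/-- The odd part of a theta series. -/
def oddSum (d a : ℕ) (c : ℂ) : ℂ⟦X⟧ := ∑' s, oddTerm d a c s

/-- A weight in m - n encodes differentiation in y of θ(xy)θ(x/y): φ = 1 gives the addition formula,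
and φ(k) = k² at y = 1 gives the second derivative needed for ℘. -/
theorem hasSum_theta_mul_theta (hd : d ≠ 0) (hba : b ≤ a) (hab : a + b ≤ d) (hc : c ≠ 0)
    (he : e ≠ 0) (φ : ℤ → ℂ) :
    HasSum (fun p : ℤ × ℤ => C (φ (p.1 - p.2)) * (monomial b e *
        (thetaTerm d (a + b) (c * e) p.1 * thetaTerm d (a - b) (c * e⁻¹) p.2)))
      (evenSum d a c * (∑' r, C (φ (2 * r)) * oddTerm d b e r) -
        oddSum d a c * ∑' r, C (φ (2 * r - 1)) * evenTerm d b e r) := by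
  rw [sub_eq_add_neg]
  refine hasSum_parity_split ?_ ?_
  · refine hasSum_of_eq ((linearOrderGrowth_evenTerm hd (by omega)).hasSum_mul
      ((linearOrderGrowth_oddTerm hd (by omega)).const_mul fun r => C (φ (2 * r))))
      (fun p => ?_) rfl
    rw [monomial_mul_thetaTerm_even hd hba hab hc he,
      show p.1 + p.2 - (p.1 - p.2) = 2 * p.2 by ring]
    ring
  · have h := ((linearOrderGrowth_oddTerm (c := c) hd (show a ≤ d by omega)).hasSum_mul
      ((linearOrderGrowth_evenTerm (c := e) hd (show b ≤ d by omega)).const_mul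
        fun r => C (φ (2 * r - 1)))).neg
    -- The odd class produces the even term at r + 1, so r is shifted by one; m - n = 2r + 1 then
    -- becomes 2r - 1.
    rw [← ((Equiv.refl ℤ).prodCongr (Equiv.addRight (1 : ℤ))).hasSum_iff] at h
    refine hasSum_of_eq h (fun p => ?_) rfl
    rw [monomial_mul_thetaTerm_odd hd hba hab hc he,
      show p.1 + p.2 + 1 - (p.1 - p.2) = 2 * (p.2 + 1) - 1 by ring]
    simp only [Function.comp_apply, Equiv.prodCongr_apply, Prod.map_fst, Prod.map_snd,
      Equiv.refl_apply, Equiv.coe_addRight]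
    ring

/-- The two-variable addition formula for theta series. -/
theorem theta_addition (hd : d ≠ 0) (hba : b ≤ a) (hab : a + b ≤ d) (hc : c ≠ 0) (he : e ≠ 0) :
    monomial b e * (thetaSum d (a + b) (c * e) (fun _ => 1) *
      thetaSum d (a - b) (c * e⁻¹) (fun _ => 1)) =
      evenSum d a c * oddSum d b e - oddSum d a c * evenSum d b e := by
  have h := hasSum_theta_mul_theta hd hba hab hc he fun _ => 1
  simp only [map_one, one_mul] at h
  refine HasSum.unique ?_ h
  have h2 := ((linearOrderGrowth_thetaTerm (c := c * e) hd hab).hasSum_mul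
    (linearOrderGrowth_thetaTerm (c := c * e⁻¹) hd (show a - b ≤ d by omega))).mul_left
    (monomial b e)
  simpa [thetaSum] using h2

theorem thetaSum_sq (hd : d ≠ 0) (ha : a ≤ d) (hc : c ≠ 0) :
    thetaSum d a c (fun _ => 1) ^ 2 =
      evenSum d a c * oddSum d 0 1 - oddSum d a c * evenSum d 0 1 := by
  rw [← theta_addition hd (Nat.zero_le a) ha hc one_ne_zero]
  simp [sq, monomial_zero_eq_C_apply]

/-- Expand (m - n)² = m² + n² - 2mn in the double sum for θ(x)². -/
theorem two_mul_thetaSum_wronskian (hd : d ≠ 0) (ha : a ≤ d) (hc : c ≠ 0) :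
    2 * (thetaSum d a c (fun _ => 1) * thetaSum d a c (fun n => n ^ 2) -
      thetaSum d a c (fun n => n) ^ 2) =
      evenSum d a c * (∑' r : ℤ, C (((2 * r : ℤ) : ℂ) ^ 2) * oddTerm d 0 1 r) -
        oddSum d a c * ∑' r : ℤ, C (((2 * r - 1 : ℤ) : ℂ) ^ 2) * evenTerm d 0 1 r := by
  refine HasSum.unique ?_
    (hasSum_theta_mul_theta hd (Nat.zero_le a) ha hc one_ne_zero fun k => (k : ℂ) ^ 2)
  have g := linearOrderGrowth_thetaTerm (c := c) hd ha
  have h1 := (g.const_mul fun n => C ((n : ℂ) ^ 2)).hasSum_mul (g.const_mul fun n => C (1 : ℂ))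
  have h2 := (g.const_mul fun n => C (1 : ℂ)).hasSum_mul (g.const_mul fun n => C ((n : ℂ) ^ 2))
  have h3 := ((g.const_mul fun n => C (n : ℂ)).hasSum_mul (g.const_mul fun n => C (n : ℂ))).mul_left
    (C (2 : ℂ))
  refine hasSum_of_eq ((h1.add h2).sub h3) (fun p => ?_) ?_
  · simp only [monomial_zero_eq_C_apply, map_one, inv_one, mul_one, Nat.add_zero, Nat.sub_zero,
      one_mul]
    push_cast
    simp only [map_pow, map_sub, map_ofNat]
    ring
  · simp only [thetaSum, map_ofNat]
    ring

/-- Specialise to x = 1, where θ vanishes and its derivative is minus the cube of the Euler product.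
-/
theorem evenSum_oddSum_wronskian (hd : d ≠ 0) :
    evenSum d 0 1 * (∑' r : ℤ, C (((2 * r : ℤ) : ℂ) ^ 2) * oddTerm d 0 1 r) -
      oddSum d 0 1 * ∑' r : ℤ, C (((2 * r - 1 : ℤ) : ℂ) ^ 2) * evenTerm d 0 1 r =
      -2 * eulerPow d ^ 6 := by
  rw [← two_mul_thetaSum_wronskian hd (Nat.zero_le d) one_ne_zero, thetaSum_one_one hd,
    thetaSum_one_id hd]
  ring

/-- The difference of two values of the Weierstrass function as a product of theta series. -/
theorem wpSum_sub_wpSum (hd : d ≠ 0) (hba : b ≤ a) (hab : a + b ≤ d) (ha : a < d) (hc : c ≠ 0)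
    (he : e ≠ 0) (hac : a ≠ 0 ∨ c ≠ 1) (hbe : b ≠ 0 ∨ e ≠ 1) :
    (wpSum d b e - wpSum d a c) *
      (thetaSum d a c (fun _ => 1) ^ 2 * thetaSum d b e (fun _ => 1) ^ 2) =
      eulerPow d ^ 6 * (monomial b e * (thetaSum d (a + b) (c * e) (fun _ => 1) *
        thetaSum d (a - b) (c * e⁻¹) (fun _ => 1))) := by
  have hx := thetaSum_logDeriv hd ha hc hac
  have hy := thetaSum_logDeriv hd (hba.trans_lt ha) he hbe
  have hx2 := two_mul_thetaSum_wronskian hd ha.le hc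
  have hy2 := two_mul_thetaSum_wronskian hd (hba.trans ha.le) he
  have hk := evenSum_oddSum_wronskian hd
  rw [hx] at hx2
  rw [hy] at hy2
  rw [theta_addition hd hba hab hc he]
  have sx := thetaSum_sq hd ha.le hc
  have sy := thetaSum_sq hd (hba.trans ha.le) he
  generalize (∑' r : ℤ, C (((2 * r : ℤ) : ℂ) ^ 2) * oddTerm d 0 1 r) = o2 at *
  generalize (∑' r : ℤ, C (((2 * r - 1 : ℤ) : ℂ) ^ 2) * evenTerm d 0 1 r) = e2 at *
  rw [sx] at hx2 ⊢
  rw [sy] at hy2 ⊢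
  have h2 : (2 : ℂ⟦X⟧) ≠ 0 := fun h => by
    simpa only [map_ofNat, map_zero, OfNat.ofNat_ne_zero] using
      congrArg (constantCoeff (R := ℂ)) h
  refine mul_left_cancel₀ h2 ?_
  -- All quantities are 2×2 determinants in four vectors: (even, odd) at x, at y and at 1, and (e2,
  -- o2). The identity is the Plücker relation between them.
  linear_combination (evenSum d b e * oddSum d 0 1 - oddSum d b e * evenSum d 0 1) * hx2 -
    (evenSum d a c * oddSum d 0 1 - oddSum d a c * evenSum d 0 1) * hy2 -
    (evenSum d a c * oddSum d b e - oddSum d a c * evenSum d b e) * hk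

end

noncomputable section

/-! ### Lambert series -/

/-- The power series `∑_{m ≥ 1} β(m) y^m`. -/
def powSum (β : ℕ → ℂ) (y : ℂ⟦X⟧) : ℂ⟦X⟧ := ∑' m : ℕ, C (β (m + 1)) * y ^ (m + 1)

theorem hasSum_powSum (β : ℕ → ℂ) {y : ℂ⟦X⟧} (hy : constantCoeff y = 0) :
    HasSum (fun m : ℕ => C (β (m + 1)) * y ^ (m + 1)) (powSum β y) := by
  refine (summable_of_X_pow_dvd fun n => Dvd.dvd.mul_left ?_ _).hasSum
  exact (pow_dvd_pow_of_dvd (X_dvd_iff.mpr hy) n).trans (pow_dvd_pow y n.le_succ)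

theorem powSum_eq_add (β : ℕ → ℂ) {y : ℂ⟦X⟧} (hy : constantCoeff y = 0) (k : ℕ) :
    powSum β y = ∑ m ∈ range k, C (β (m + 1)) * y ^ (m + 1) +
      y ^ k * powSum (fun m => β (m + k)) y := by
  rw [powSum, ← (hasSum_powSum β hy).summable.sum_add_tsum_nat_add k]
  congr 1
  refine ((((hasSum_powSum (fun m => β (m + k)) hy).mul_left (y ^ k))).tsum_eq.symm.trans
    (tsum_congr fun m => ?_)).symm
  rw [add_right_comm]
  ring

theorem powSum_add (β γ : ℕ → ℂ) {y : ℂ⟦X⟧} (hy : constantCoeff y = 0) :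
    powSum (fun m => β m + γ m) y = powSum β y + powSum γ y := by
  refine (hasSum_powSum _ hy).unique
    (hasSum_of_eq ((hasSum_powSum β hy).add (hasSum_powSum γ hy)) (fun m => ?_) rfl)
  rw [map_add]; ring

theorem powSum_const_mul (r : ℂ) (β : ℕ → ℂ) {y : ℂ⟦X⟧} (hy : constantCoeff y = 0) :
    powSum (fun m => r * β m) y = C r * powSum β y := by
  refine (hasSum_powSum _ hy).unique
    (hasSum_of_eq ((hasSum_powSum β hy).mul_left (C r)) (fun m => ?_) rfl)
  rw [map_mul]; ring

theorem one_sub_mul_inv {y : ℂ⟦X⟧} (hy : constantCoeff y = 0) : (1 - y) * (1 - y)⁻¹ = 1 :=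
  PowerSeries.mul_inv_cancel _ (by simp [hy])

theorem powSum_one {y : ℂ⟦X⟧} (hy : constantCoeff y = 0) :
    powSum (fun _ => 1) y = y * (1 - y)⁻¹ := by
  have h := powSum_eq_add (fun _ => 1) hy 1
  simp only [sum_range_one, map_one] at h
  linear_combination (1 - y)⁻¹ * h - powSum (fun _ => 1) y * one_sub_mul_inv hy

theorem powSum_id {y : ℂ⟦X⟧} (hy : constantCoeff y = 0) : powSum (fun m => m) y = koebe y := by
  have h := powSum_eq_add (fun m => (m : ℂ)) hy 1
  simp only [sum_range_one, Nat.cast_add, Nat.cast_one, powSum_add _ _ hy, powSum_one hy, zero_add,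
    map_one, Nat.cast_zero, pow_one] at h
  rw [koebe]
  linear_combination (1 - y)⁻¹ * h -
    (powSum (fun m => (m : ℂ)) y + y * (1 - y)⁻¹) * one_sub_mul_inv hy

theorem powSum_periodic {β : ℕ → ℂ} (hβ : ∀ m, β (m + 5) = β m) (h0 : β 0 = 0) {y : ℂ⟦X⟧}
    (hy : constantCoeff y = 0) :
    powSum β y = (1 - y ^ 5)⁻¹ * ∑ m ∈ Icc 1 4, C (β m) * y ^ m := by
  have h := powSum_eq_add β hy 5
  simp only [hβ, sum_range_succ, range_zero, sum_empty, zero_add, Nat.reduceAdd, h0, map_zero,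
    zero_mul, add_zero] at h
  have h1 : ∑ m ∈ Icc 1 4, C (β m) * y ^ m =
      C (β 1) * y ^ 1 + C (β 2) * y ^ 2 + C (β 3) * y ^ 3 + C (β 4) * y ^ 4 := by
    rw [show Icc 1 4 = ({1, 2, 3, 4} : Finset ℕ) from rfl]
    simp [add_assoc]
  rw [h1]
  linear_combination (1 - y ^ 5)⁻¹ * h -
    powSum β y * one_sub_mul_inv (y := y ^ 5) (by simp [hy])

theorem constantCoeff_X_pow_succ (n : ℕ) : constantCoeff (X ^ (n + 1) : ℂ⟦X⟧) = 0 := by simp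

theorem powSum_C_mul (β : ℕ → ℂ) (c : ℂ) (y : ℂ⟦X⟧) :
    powSum β (C c * y) = powSum (fun m => β m * c ^ m) y := by
  rw [powSum, powSum]
  refine tsum_congr fun m => ?_
  rw [mul_pow, map_mul, map_pow]; ring

theorem summable_lambert (α β : ℕ → ℂ) : Summable fun p : ℕ × ℕ =>
    (C (α (p.1 + 1)) * (C (β (p.2 + 1)) * (X ^ (p.1 + 1)) ^ (p.2 + 1)) : ℂ⟦X⟧) := by
  refine summable_of_finite_coeff fun k => ((Set.finite_Iic k).prod (Set.finite_Iic k)).subset ?_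
  intro p hp
  have hk : k = (p.1 + 1) * (p.2 + 1) := by
    by_contra hk
    rw [Set.mem_ofPred_eq, ← pow_mul, ← mul_assoc, ← map_mul, coeff_C_mul, coeff_X_pow,
      if_neg hk, mul_zero] at hp
    exact hp rfl
  rw [Set.mem_prod, Set.mem_Iic, Set.mem_Iic, hk]
  constructor <;> nlinarith

theorem hasSum_lambert (α β : ℕ → ℂ) :
    HasSum (fun n => C (α (n + 1)) * powSum β (X ^ (n + 1)))
      (∑' p : ℕ × ℕ, (C (α (p.1 + 1)) * (C (β (p.2 + 1)) * (X ^ (p.1 + 1)) ^ (p.2 + 1)))) := by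
  have h1 := (summable_lambert α β).hasSum
  have h2 : ∀ n : ℕ, HasSum (fun m : ℕ =>
      C (α (n + 1)) * (C (β (m + 1)) * (X ^ (n + 1)) ^ (m + 1)))
      (C (α (n + 1)) * powSum β (X ^ (n + 1))) := fun n =>
    HasSum.mul_left (C (α (n + 1))) (hasSum_powSum β (constantCoeff_X_pow_succ n))
  have : RegularSpace ℂ⟦X⟧ := inferInstance
  exact h1.prod_fiberwise h2

/-- Both sides sum α(n)β(m)q^{nm} over all pairs. The exchange puts the character on the outer index
for L and on the inner one for E. -/
theorem lambert_swap (α β : ℕ → ℂ) :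
    ∑' n, C (α (n + 1)) * powSum β (X ^ (n + 1)) =
      ∑' n, C (β (n + 1)) * powSum α (X ^ (n + 1)) := by
  rw [(hasSum_lambert α β).tsum_eq, (hasSum_lambert β α).tsum_eq,
    ← (Equiv.prodComm ℕ ℕ).tsum_eq]
  refine tsum_congr fun p => ?_
  simp only [Equiv.prodComm_apply, Prod.fst_swap, Prod.snd_swap, ← pow_mul]
  rw [mul_comm (p.2 + 1)]
  ring

/-! ### Theta series with modulus five as products -/

theorem tendsto_eulerPow_mul_thetaFin_mul {d a b : ℕ} {c e : ℂ} (hd : d ≠ 0) (ha : a ≤ d)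
    (hb : b ≤ d) :
    Tendsto (fun N => eulerPow d ^ 2 * (thetaFin d a c N (fun _ => 1) *
      thetaFin d b e N (fun _ => 1))) atTop
      (𝓝 (thetaSum d a c (fun _ => 1) * thetaSum d b e (fun _ => 1))) :=
  ((tendsto_eulerPow_mul_thetaFin hd ha _).mul (tendsto_eulerPow_mul_thetaFin hd hb _)).congr
    fun N => by ring

/-- The theta products at q and q² with base q^5 run over exponents ≡ ±1 and ≡ ±2 mod 5; the
multiples of 5 complete the Euler product. -/
theorem thetaFin_five_mul (N : ℕ) :
    thetaFin 5 1 1 N (fun _ => 1) * thetaFin 5 2 1 N (fun _ => 1) * qPoch 5 N =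
      qPoch 1 (5 * N) := by
  induction N with
  | zero => simp [thetaFin_zero, qPoch_zero]
  | succ N ih =>
    have h5 : (5 : ℕ) ≠ 0 := by norm_num
    rw [thetaFin_one_succ h5 (by norm_num) one_ne_zero,
      thetaFin_one_succ h5 (by norm_num) one_ne_zero, qPoch_succ,
      show 5 * (N + 1) = 5 * N + 1 + 1 + 1 + 1 + 1 by ring]
    simp only [qPoch_succ 1, ← ih, inv_one, ← X_pow_eq, one_mul]
    ring

theorem thetaSum_five_mul :
    thetaSum 5 1 1 (fun _ => 1) * thetaSum 5 2 1 (fun _ => 1) = eulerPow 5 * euler := by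
  have h5 : (5 : ℕ) ≠ 0 := by norm_num
  have h1 := (tendsto_eulerPow_mul_thetaFin_mul (a := 1) (b := 2) (c := 1) (e := 1) h5
    (by norm_num) (by norm_num)).mul (tendsto_qPoch h5)
  have h2 := ((tendsto_qPoch one_ne_zero).comp
    (tendsto_id.const_mul_atTop' (show 0 < 5 by norm_num))).const_mul (eulerPow 5 ^ 2)
  have h := tendsto_nhds_unique h1 (h2.congr fun N => by
    rw [Function.comp_apply, id_eq, ← thetaFin_five_mul]; ring)
  refine mul_right_cancel₀ (eulerPow_ne_zero h5) ?_
  rw [h, eulerPow_one]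
  ring

variable {ζ : ℂ}

theorem prod_one_sub_root (hζ : ζ ^ 4 + ζ ^ 3 + ζ ^ 2 + ζ + 1 = 0) (y : ℂ⟦X⟧) :
    (1 - C (ζ ^ 4) * y) * (1 - C (ζ ^ 3) * y) * (1 - y) * (1 - C ζ * y) * (1 - C (ζ ^ 2) * y) =
      1 - y ^ 5 := by
  have h : (C ζ ^ 4 + C ζ ^ 3 + C ζ ^ 2 + C ζ + 1 : ℂ⟦X⟧) = 0 := by
    rw [← map_zero C, ← hζ]; simp
  simp only [map_pow]
  generalize (C ζ : ℂ⟦X⟧) = w at *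
  linear_combination (-y + (w + w ^ 3) * y ^ 2 - (w ^ 3 + w ^ 5) * y ^ 3 + w ^ 6 * y ^ 4 -
    (w - 1) * (w ^ 5 + 1) * y ^ 5) * h

theorem root_pow_five (hζ : ζ ^ 4 + ζ ^ 3 + ζ ^ 2 + ζ + 1 = 0) : ζ ^ 5 = 1 := by
  linear_combination (ζ - 1) * hζ

theorem root_ne_zero (hζ : ζ ^ 4 + ζ ^ 3 + ζ ^ 2 + ζ + 1 = 0) : ζ ≠ 0 := by
  rintro rfl
  simp at hζ

theorem root_inv (hζ : ζ ^ 4 + ζ ^ 3 + ζ ^ 2 + ζ + 1 = 0) : ζ⁻¹ = ζ ^ 4 :=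
  inv_eq_of_mul_eq_one_right (by linear_combination root_pow_five hζ)

theorem root_sq_inv (hζ : ζ ^ 4 + ζ ^ 3 + ζ ^ 2 + ζ + 1 = 0) : (ζ ^ 2)⁻¹ = ζ ^ 3 :=
  inv_eq_of_mul_eq_one_right (by linear_combination root_pow_five hζ)

/-- The finite theta product at ζ uses 1 - ζq^i for i < N but 1 - ζ⁻¹q^i for 1 ≤ i ≤ N, and likewise
at ζ². The added factors at i = N and the constants at i = 0 repair this mismatch, after which the
five roots combine into 1 - q^{5i}. -/
theorem thetaFin_root_mul (hζ : ζ ^ 4 + ζ ^ 3 + ζ ^ 2 + ζ + 1 = 0) (N : ℕ) :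
    thetaFin 1 0 ζ N (fun _ => 1) * thetaFin 1 0 (ζ ^ 2) N (fun _ => 1) * qPoch 1 N *
      ((1 - C ζ * X ^ N) * (1 - C (ζ ^ 2) * X ^ N)) =
      C ((1 - ζ) * (1 - ζ ^ 2)) * qPoch 5 N := by
  have h0 := root_ne_zero hζ
  induction N with
  | zero => simp [thetaFin_zero, qPoch_zero]
  | succ N ih =>
    have hp := prod_one_sub_root hζ (X ^ (N + 1))
    rw [thetaFin_one_succ one_ne_zero zero_le_one h0,
      thetaFin_one_succ one_ne_zero zero_le_one (pow_ne_zero 2 h0), qPoch_succ, qPoch_succ,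
      root_inv hζ, root_sq_inv hζ, mul_comm 5 (N + 1), pow_mul X (N + 1) 5, ← hp]
    simp only [monomial_eq_C_mul_X_pow, pow_zero, mul_one, Nat.sub_zero, pow_one, one_mul,
      pow_succ X N] at *
    linear_combination ((1 - C (ζ ^ 4) * (X ^ N * X)) * (1 - C (ζ ^ 3) * (X ^ N * X)) *
      (1 - X ^ N * X) * (1 - C ζ * (X ^ N * X)) * (1 - C (ζ ^ 2) * (X ^ N * X))) * ih

theorem thetaSum_root_mul (hζ : ζ ^ 4 + ζ ^ 3 + ζ ^ 2 + ζ + 1 = 0) :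
    thetaSum 1 0 ζ (fun _ => 1) * thetaSum 1 0 (ζ ^ 2) (fun _ => 1) =
      C ((1 - ζ) * (1 - ζ ^ 2)) * (euler * eulerPow 5) := by
  have h5 : (5 : ℕ) ≠ 0 := by norm_num
  have hX : Tendsto (fun N => (X : ℂ⟦X⟧) ^ N) atTop (𝓝 0) :=
    tendsto_of_X_pow_dvd fun N => by simp
  have h0 := ((hX.const_mul (C ζ)).const_sub 1).mul ((hX.const_mul (C (ζ ^ 2))).const_sub 1)
  have h1 := ((tendsto_eulerPow_mul_thetaFin_mul (a := 0) (b := 0) (c := ζ) (e := ζ ^ 2)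
    one_ne_zero zero_le_one zero_le_one).mul (tendsto_qPoch one_ne_zero)).mul h0
  have h2 := (tendsto_qPoch h5).const_mul (eulerPow 1 ^ 2 * C ((1 - ζ) * (1 - ζ ^ 2)))
  have h := tendsto_nhds_unique h1 (h2.congr fun N => by
    linear_combination -eulerPow 1 ^ 2 * thetaFin_root_mul hζ N)
  refine mul_right_cancel₀ (eulerPow_ne_zero one_ne_zero) ?_
  rw [eulerPow_one] at h ⊢
  linear_combination h

/-! ### Reflection formulas -/

/-- Substitute n ↦ -n: this is θ(Q/x) = θ(x). -/
theorem thetaSum_reflect {d a : ℕ} {c : ℂ} (ha : a ≤ d) :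
    thetaSum d (d - a) c⁻¹ (fun _ => 1) = thetaSum d a c (fun _ => 1) := by
  rw [thetaSum, thetaSum, ← (Equiv.neg ℤ).tsum_eq]
  refine tsum_congr fun n => ?_
  rw [Equiv.neg_apply, thetaTerm, thetaTerm]
  congr 1
  refine congrArg₂ (fun k z => monomial k z) ?_ ?_
  · zify
    have h1 := two_mul_thetaExp ha n
    have h2 := two_mul_thetaExp (Nat.sub_le d a) (-n)
    push_cast [ha] at h2
    refine mul_left_cancel₀ (two_ne_zero (α := ℤ)) ?_
    linear_combination h2 - h1
  · rw [← inv_neg, inv_zpow, zpow_neg, inv_inv]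

/-- Substitute n ↦ 1 - n, which preserves n(n-1)/2. -/
theorem thetaSum_inv {d : ℕ} {c : ℂ} (hd : d ≠ 0) (hc : c ≠ 0) :
    thetaSum d 0 c (fun _ => 1) = -(C c * thetaSum d 0 c⁻¹ (fun _ => 1)) := by
  refine HasSum.unique (hasSum_thetaSum hd (Nat.zero_le d) _) ?_
  have h := ((hasSum_thetaSum (c := c⁻¹) hd (Nat.zero_le d) fun _ => 1).mul_left (C c)).neg
  rw [← (Equiv.subLeft (1 : ℤ)).hasSum_iff] at h
  refine hasSum_of_eq h (fun n => ?_) rfl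
  simp only [Function.comp_apply, Equiv.subLeft_apply, map_one, one_mul, thetaTerm, ← smul_eq_C_mul,
    ← map_smul, ← map_neg]
  refine congrArg₂ (fun k z => monomial k z) ?_ ?_
  · zify
    have h1 := two_mul_thetaExp (Nat.zero_le d) n
    have h2 := two_mul_thetaExp (Nat.zero_le d) (1 - n)
    refine mul_left_cancel₀ (two_ne_zero (α := ℤ)) ?_
    push_cast at h1 h2
    linear_combination h1 - h2
  · rw [← inv_neg, inv_zpow, ← zpow_neg, neg_sub, zpow_sub_one₀ (neg_ne_zero.mpr hc), smul_eq_mul]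
    field_simp

end

noncomputable section

/-! ### The character modulo five -/

theorem chi35_apply (a : ZMod 5) : chi35 a = (chi35Int a : ℂ) := rfl

theorem chi35_natCast_add (r n : ℕ) : chi35 ((r + 5 * n : ℕ) : ZMod 5) = chi35 (r : ZMod 5) := by
  rw [Nat.cast_add, Nat.cast_mul, show ((5 : ℕ) : ZMod 5) = 0 from rfl, zero_mul, add_zero]

theorem chi35_zero : chi35 ((0 : ℕ) : ZMod 5) = 0 := by
  rw [chi35_apply, show chi35Int ((0 : ℕ) : ZMod 5) = 0 from rfl, Int.cast_zero]

theorem chi35_one : chi35 ((1 : ℕ) : ZMod 5) = 1 := by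
  rw [chi35_apply, show chi35Int ((1 : ℕ) : ZMod 5) = 1 from rfl, Int.cast_one]

theorem chi35_two : chi35 ((2 : ℕ) : ZMod 5) = -1 := by
  rw [chi35_apply, show chi35Int ((2 : ℕ) : ZMod 5) = -1 from rfl, Int.cast_neg, Int.cast_one]

theorem chi35_three : chi35 ((3 : ℕ) : ZMod 5) = -1 := by
  rw [chi35_apply, show chi35Int ((3 : ℕ) : ZMod 5) = -1 from rfl, Int.cast_neg, Int.cast_one]

theorem chi35_four : chi35 ((4 : ℕ) : ZMod 5) = 1 := by
  rw [chi35_apply, show chi35Int ((4 : ℕ) : ZMod 5) = 1 from rfl, Int.cast_one]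

/-- L(-1, χ) is 5 times the χ-weighted sum of the Hurwitz values ζ(-1, j/5) = -B₂(j/5)/2. -/
theorem LFunction_chi35_neg_one : DirichletCharacter.LFunction chi35 (-1) = -2 / 5 := by
  have hB : ∀ x : ℂ,
      ((Polynomial.bernoulli 2).map (algebraMap ℚ ℂ)).eval x = x ^ 2 - x + 1 / 6 := by
    intro x
    simp only [Polynomial.bernoulli_def, sum_range_succ, range_zero, sum_empty, Nat.sub_zero,
      Nat.reduceSub, bernoulli_zero, bernoulli_one, bernoulli_two, Polynomial.map_add,
      Polynomial.map_monomial, Polynomial.eval_add, Polynomial.eval_monomial]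
    norm_num [Nat.choose]
    ring
  have hz : ∀ j : ZMod 5, HurwitzZeta.hurwitzZeta (ZMod.toAddCircle j) (-1) =
      -1 / 2 * (((j.val : ℂ) / 5) ^ 2 - (j.val : ℂ) / 5 + 1 / 6) := by
    intro j
    have h := HurwitzZeta.hurwitzZeta_neg_nat (k := 1) one_ne_zero (x := (j.val : ℝ) / 5)
      ⟨by positivity, by
        have := j.val_lt
        rw [div_le_one (by norm_num)]
        exact_mod_cast this.le⟩
    rw [hB] at h
    rw [ZMod.toAddCircle_apply]
    push_cast at h ⊢
    rw [h]
    norm_num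
  have h5 : ((5 : ℕ) : ℂ) ^ (-(-1) : ℂ) = 5 := by simp
  rw [DirichletCharacter.LFunction, ZMod.LFunction, h5]
  simp only [hz]
  have hsum : ∀ f : ZMod 5 → ℂ, ∑ j, f j = f (0 : ℕ) + f (1 : ℕ) + f (2 : ℕ) + f (3 : ℕ) +
      f (4 : ℕ) := fun f => Fin.sum_univ_five f
  rw [hsum, chi35_zero, chi35_one, chi35_two, chi35_three, chi35_four]
  simp only [ZMod.val_natCast]
  norm_num

/-! ### The Eisenstein series as eta quotients -/

theorem L_eq_tsum : L = ∑' n, C (chi35 ((n + 1 : ℕ) : ZMod 5)) * koebe (X ^ (n + 1)) := by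
  have h := lambert_swap (fun n => (n : ℂ)) (fun n => chi35 (n : ZMod 5))
  simp only [powSum_id (constantCoeff_X_pow_succ _)] at h
  rw [← h, L, lSeries]
  refine tsum_congr fun n => ?_
  rw [lTerm, powSum_periodic (fun m => chi35_natCast_add m 1) chi35_zero
    (constantCoeff_X_pow_succ n), mul_assoc, ← pow_mul, mul_comm (n + 1) 5]
  simp only [← pow_mul, mul_comm (n + 1)]

/-- After the Lambert exchange L = ∑ χ(n) q^n/(1 - q^n)². The classes ±1 mod 5 form one ℘-sum and ±2
the other; partial sums are compared in blocks of five. -/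
theorem L_eq_wpSum_sub : L = wpSum 5 1 1 - wpSum 5 2 1 := by
  have h5 : (5 : ℕ) ≠ 0 := by norm_num
  have h1 := ((hasSum_lambert (fun n => chi35 (n : ZMod 5)) (fun n => (n : ℂ))).summable.hasSum)
  simp only [powSum_id (constantCoeff_X_pow_succ _)] at h1
  rw [← L_eq_tsum] at h1
  have h2 := h1.tendsto_sum_nat.comp (tendsto_id.const_mul_atTop' (show 0 < 5 by norm_num))
  have h3 := ((hasSum_wpTerm (a := 1) (c := 1) h5).sub
    (hasSum_wpTerm (a := 2) (c := 1) h5)).tendsto_sum_nat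
  refine tendsto_nhds_unique h2 (h3.congr fun N => ?_)
  rw [Function.comp_apply, id_eq]
  induction N with
  | zero => simp
  | succ N ih =>
    rw [sum_range_succ, ih, show 5 * (N + 1) = 5 * N + 1 + 1 + 1 + 1 + 1 by ring]
    simp only [sum_range_succ, wpTerm, inv_one, ← X_pow_eq, ← pow_add]
    rw [show 5 * N + 1 = 1 + 5 * N by ring, show 1 + 5 * N + 1 = 2 + 5 * N by ring,
      show 5 * N + 2 + 1 = 3 + 5 * N by ring, show 3 + 5 * N + 1 = 4 + 5 * N by ring,
      show 5 * N + 4 + 1 = 0 + 5 * (N + 1) by ring]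
    simp only [Nat.reduceSub, chi35_natCast_add, chi35_zero, chi35_one, chi35_two, chi35_three,
      chi35_four, map_one, map_neg, map_zero]
    ring

theorem L_mul_euler : L * euler = X * eulerPow 5 ^ 5 := by
  have h5 : (5 : ℕ) ≠ 0 := by norm_num
  have h := wpSum_sub_wpSum (d := 5) (a := 2) (b := 1) (c := 1) (e := 1) h5 (by norm_num)
    (by norm_num) (by norm_num) one_ne_zero one_ne_zero (by norm_num) (by norm_num)
  -- The product xy = q³ reflects to q², so the same two theta series occur on both sides.
  have hr := thetaSum_reflect (d := 5) (a := 2) (c := 1) (by norm_num)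
  norm_num only [inv_one, mul_one] at h hr
  rw [← L_eq_wpSum_sub, hr, ← mul_pow, mul_comm (thetaSum 5 2 1 _), thetaSum_five_mul,
    monomial_eq_C_mul_X_pow, map_one, pow_one, one_mul] at h
  have hE := eulerPow_ne_zero one_ne_zero
  rw [eulerPow_one] at hE
  refine mul_right_cancel₀ (mul_ne_zero (pow_ne_zero 2 (eulerPow_ne_zero h5)) hE) ?_
  linear_combination h

variable {ζ : ℂ}

theorem wpSum_eq_add_tsum {c : ℂ} : wpSum 1 0 c = koebe (C c) +
    ∑' n, powSum (fun m => (m : ℂ) * (c ^ m + c⁻¹ ^ m)) (X ^ (n + 1)) := by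
  have h1 := (tendsto_add_atTop_iff_nat 1).mpr
    (hasSum_wpTerm (a := 0) (c := c) one_ne_zero).tendsto_sum_nat
  have h2 := (hasSum_lambert (fun _ => 1)
    (fun m => (m : ℂ) * (c ^ m + c⁻¹ ^ m))).summable.hasSum.tendsto_sum_nat
  simp only [map_one, one_mul] at h2
  -- Pairing c q^i with c⁻¹q^i leaves the constant term at i = 0 and one unmatched summand at the
  -- far end, which tends to 0.
  have h3 : Tendsto (fun N => koebe (C c⁻¹ * X ^ (N + 1))) atTop (𝓝 0) :=
    tendsto_of_X_pow_dvd fun N => by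
      rw [sub_zero, koebe]
      exact ((pow_dvd_pow X N.le_succ).mul_left _).mul_right _
  refine tendsto_nhds_unique h1 ?_
  have h4 := (h2.const_add (koebe (C c))).add h3
  rw [add_zero] at h4
  refine h4.congr fun N => ?_
  induction N with
  | zero => simp [wpTerm, monomial_eq_C_mul_X_pow]
  | succ N ih =>
    have hN := constantCoeff_X_pow_succ N
    have e : powSum (fun m => (m : ℂ) * (c ^ m + c⁻¹ ^ m)) (X ^ (N + 1)) =
        koebe (C c * X ^ (N + 1)) + koebe (C c⁻¹ * X ^ (N + 1)) := by
      rw [← powSum_id (by simp), ← powSum_id (by simp), powSum_C_mul, powSum_C_mul,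
        ← powSum_add _ _ hN]
      simp only [mul_add]
    rw [sum_range_succ _ (N + 1), ← ih, sum_range_succ _ N, e, wpTerm]
    simp only [monomial_eq_C_mul_X_pow, pow_zero, mul_one, one_mul, Nat.sub_zero, pow_one]
    rw [mul_assoc (C c⁻¹), ← pow_succ']
    ring

/-- The Fourier transform of χ is χ times its Gauss sum ζ - ζ² - ζ³ + ζ⁴ = (1 - ζ)(1 - ζ²)ζ. -/
theorem root_pow_sub (hζ : ζ ^ 4 + ζ ^ 3 + ζ ^ 2 + ζ + 1 = 0) (m : ℕ) :
    (ζ ^ 2) ^ m + (ζ ^ 2)⁻¹ ^ m - (ζ ^ m + ζ⁻¹ ^ m) =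
      -((1 - ζ) * (1 - ζ ^ 2) * ζ) * chi35 (m : ZMod 5) := by
  have h5 := root_pow_five hζ
  rw [root_inv hζ, root_sq_inv hζ]
  have hm := Nat.mod_add_div m 5
  have hlt := Nat.mod_lt m (show 5 > 0 by norm_num)
  generalize m % 5 = r at hm hlt
  generalize m / 5 = k at hm
  subst hm
  rw [chi35_natCast_add]
  have hp : ∀ x : ℂ, x ^ 5 = 1 → x ^ (r + 5 * k) = x ^ r := fun x hx => by
    rw [pow_add, pow_mul, hx, one_pow, mul_one]
  rw [hp ζ h5, hp (ζ ^ 2) (by rw [← pow_mul, mul_comm, pow_mul, h5, one_pow]),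
    hp (ζ ^ 3) (by rw [← pow_mul, mul_comm, pow_mul, h5, one_pow]),
    hp (ζ ^ 4) (by rw [← pow_mul, mul_comm, pow_mul, h5, one_pow])]
  interval_cases r
  · rw [chi35_zero]; ring
  · rw [chi35_one]; ring
  · rw [chi35_two]
    linear_combination (ζ - ζ ^ 3) * h5
  · rw [chi35_three]
    linear_combination (ζ + ζ ^ 4 - ζ ^ 2 * (ζ ^ 5 + 1)) * h5
  · rw [chi35_four]
    linear_combination (ζ ^ 3 + ζ ^ 2 * (ζ ^ 5 + 1) - ζ * (ζ ^ 10 + ζ ^ 5 + 1)) * h5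

theorem root_ne_one (hζ : ζ ^ 4 + ζ ^ 3 + ζ ^ 2 + ζ + 1 = 0) : ζ ≠ 1 := by
  rintro rfl
  norm_num at hζ

theorem root_sq_ne_one (hζ : ζ ^ 4 + ζ ^ 3 + ζ ^ 2 + ζ + 1 = 0) : ζ ^ 2 ≠ 1 := fun h =>
  root_ne_one hζ (by linear_combination root_pow_five hζ - ζ * (1 + ζ ^ 2) * h)

/-- Let ρ be the Gauss sum. The constant terms of the ℘-sums differ by 1/ρ, giving the 1 in E; the
Lambert part gets the coefficient -ρ² = -5 = 2/L(-1, χ). -/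
theorem E_eq_wpSum_sub (hζ : ζ ^ 4 + ζ ^ 3 + ζ ^ 2 + ζ + 1 = 0) :
    E = C ((1 - ζ) * (1 - ζ ^ 2) * ζ) * (wpSum 1 0 (ζ ^ 2) - wpSum 1 0 ζ) := by
  set ρ := (1 - ζ) * (1 - ζ ^ 2) * ζ with hρ
  have h1 : 1 - ζ ≠ 0 := sub_ne_zero.mpr (root_ne_one hζ).symm
  have h2 : 1 - ζ ^ 2 ≠ 0 := sub_ne_zero.mpr (root_sq_ne_one hζ).symm
  have hk : ∀ c : ℂ, koebe (C c) = C (c / (1 - c) ^ 2) := fun c => by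
    rw [koebe, ← map_one C, ← map_sub, PowerSeries.C_inv, ← map_pow, ← map_mul, inv_pow,
      div_eq_mul_inv]
  have hconst : ρ * (ζ ^ 2 / (1 - ζ ^ 2) ^ 2 - ζ / (1 - ζ) ^ 2) = 1 := by
    rw [hρ]
    rw [div_sub_div _ _ (pow_ne_zero 2 h2) (pow_ne_zero 2 h1), ← mul_div_assoc,
      div_eq_one_iff_eq (mul_ne_zero (pow_ne_zero 2 h2) (pow_ne_zero 2 h1))]
    linear_combination -((1 - ζ) ^ 3 * (1 - ζ ^ 2)) * hζ
  have hsq : ρ * ρ = 5 := by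
    linear_combination (ζ ^ 4 - 3 * ζ ^ 3 + ζ ^ 2 + 5 * ζ - 5) * hζ
  have hs : ∀ n, powSum (fun m => (m : ℂ) * ((ζ ^ 2) ^ m + (ζ ^ 2)⁻¹ ^ m)) (X ^ (n + 1)) -
      powSum (fun m => (m : ℂ) * (ζ ^ m + ζ⁻¹ ^ m)) (X ^ (n + 1)) =
      C (-ρ) * powSum (fun m => chi35 (m : ZMod 5) * m) (X ^ (n + 1)) := by
    intro n
    rw [← powSum_const_mul _ _ (constantCoeff_X_pow_succ n), sub_eq_iff_eq_add,
      ← powSum_add _ _ (constantCoeff_X_pow_succ n)]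
    congr 1
    funext m
    linear_combination (m : ℂ) * root_pow_sub hζ m
  have summ : ∀ β : ℕ → ℂ, Summable fun n => powSum β (X ^ (n + 1)) := fun β => by
    simpa using (hasSum_lambert (fun _ => 1) β).summable
  have hE : ∑' n : ℕ, eTerm chi35 (n + 1) =
      ∑' n, powSum (fun m => chi35 (m : ZMod 5) * m) (X ^ (n + 1)) := by
    have h := lambert_swap (fun n => chi35 (n : ZMod 5) * n) (fun _ => 1)
    simp only [powSum_one (constantCoeff_X_pow_succ _), map_one, one_mul] at h
    rw [← h]
    refine tsum_congr fun n => ?_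
    rw [eTerm, mul_assoc]
  rw [E, eSeries, LFunction_chi35_neg_one, hE, wpSum_eq_add_tsum, wpSum_eq_add_tsum,
    add_sub_add_comm, ← (summ _).tsum_sub (summ _), tsum_congr hs, (summ _).tsum_mul_left, hk, hk,
    ← map_sub, mul_add, ← map_mul, hconst, ← mul_assoc, ← map_mul, map_one,
    show ρ * -ρ = 2 / (-2 / 5) by rw [mul_neg, hsq]; norm_num]

theorem E_mul_eulerPow_five : E * eulerPow 5 = euler ^ 5 := by
  obtain ⟨ζ, hζ⟩ : ∃ ζ : ℂ, ζ ^ 4 + ζ ^ 3 + ζ ^ 2 + ζ + 1 = 0 := by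
    have h := (Complex.isPrimitiveRoot_exp 5 (by norm_num)).geom_sum_eq_zero (by norm_num)
    simp only [sum_range_succ, range_zero, sum_empty] at h
    exact ⟨_, by linear_combination h⟩
  have h0 := root_ne_zero hζ
  have h1 := root_ne_one hζ
  have h21 := root_sq_ne_one hζ
  -- Here xy = ζ³ = (ζ²)⁻¹ and x/y = ζ⁻¹, so by inversion the right side again involves θ(ζ)θ(ζ²).
  have h := wpSum_sub_wpSum (d := 1) (a := 0) (b := 0) (c := ζ) (e := ζ ^ 2) one_ne_zero le_rfl
    zero_le_one one_pos h0 (pow_ne_zero 2 h0) (Or.inr h1) (Or.inr h21)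
  have hr1 := thetaSum_inv one_ne_zero h0
  have hr2 := thetaSum_inv one_ne_zero (pow_ne_zero 2 h0)
  have hz : ζ * (ζ ^ 2)⁻¹ = ζ⁻¹ := by field_simp
  have hz2 : ζ * ζ ^ 2 = (ζ ^ 2)⁻¹ := by rw [root_sq_inv hζ]; ring
  have hS := thetaSum_root_mul hζ
  have hE := eulerPow_ne_zero one_ne_zero
  rw [eulerPow_one] at h hE
  have hne : thetaSum 1 0 ζ (fun _ => 1) * thetaSum 1 0 (ζ ^ 2) (fun _ => 1) ≠ 0 := by
    rw [hS]
    refine mul_ne_zero ?_ (mul_ne_zero hE (eulerPow_ne_zero (by norm_num)))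
    rw [Ne, map_eq_zero_iff C C_injective]
    exact mul_ne_zero (sub_ne_zero.mpr h1.symm) (sub_ne_zero.mpr h21.symm)
  rw [hz, hz2, Nat.add_zero, Nat.sub_zero, monomial_zero_eq_C_apply] at h
  have key : C ζ * (wpSum 1 0 (ζ ^ 2) - wpSum 1 0 ζ) * (thetaSum 1 0 ζ (fun _ => 1) *
      thetaSum 1 0 (ζ ^ 2) (fun _ => 1)) = euler ^ 6 := by
    refine mul_right_cancel₀ hne ?_
    have hprod : thetaSum 1 0 ζ (fun _ => 1) * thetaSum 1 0 (ζ ^ 2) (fun _ => 1) =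
        C ζ * thetaSum 1 0 ζ⁻¹ (fun _ => 1) *
          (C (ζ ^ 2) * thetaSum 1 0 (ζ ^ 2)⁻¹ (fun _ => 1)) := by
      rw [hr1, hr2]; ring
    linear_combination C ζ * h - euler ^ 6 * hprod
  refine mul_right_cancel₀ hE ?_
  rw [E_eq_wpSum_sub hζ, map_mul]
  rw [hS] at key
  linear_combination key

end

noncomputable section

/-! ### Partitions along arithmetic progressions -/

/-- The generating series `∑_N p(5^k N - s) q^N`. -/
def progSeries (k s : ℕ) : ℂ⟦X⟧ :=
  PowerSeries.mk fun N => (partitionCount (5 ^ k * (N : ℤ) - s) : ℂ)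

theorem partitionCount_of_neg {n : ℤ} (hn : n < 0) : partitionCount n = 0 := by
  simp [partitionCount, hn]

theorem progSeries_zero_zero_mul_euler : progSeries 0 0 * euler = 1 := by
  have h1 := Nat.Partition.hasProd_powerSeriesMk_card_restricted ℂ fun _ => True
  have h2 := (WithPiTopology.multipliable_one_sub_X_pow ℂ).hasProd
  have h := h1.mul h2
  have e : progSeries 0 0 = PowerSeries.mk fun n =>
      ((Nat.Partition.restricted n fun _ => True).card : ℂ) := by
    ext n
    simp [progSeries, partitionCount, Nat.Partition.restricted, card_univ]
  rw [e, euler]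
  refine h.unique ?_
  convert hasProd_one using 1
  funext i
  have := WithPiTopology.tsum_pow_mul_one_sub_of_constantCoeff_eq_zero
    (constantCoeff_X_pow_succ i)
  simpa only [if_true, pow_mul] using this

theorem progSeries_zero_one : progSeries 0 1 = X * progSeries 0 0 := by
  ext N
  cases N with
  | zero => simp [progSeries, partitionCount]
  | succ N => simp [progSeries, coeff_succ_X_mul]

theorem Omega_sub (m : ℕ) (f g : ℂ⟦X⟧) : Omega m (f - g) = Omega m f - Omega m g := by
  ext n
  simp [Omega]

/-- The bound on m ensures that n < k forces 5n + m < 5k, so no low coefficients appear. -/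
theorem Omega_X_pow_mul {m : ℕ} (hm : m ≤ 4) (k : ℕ) (f : ℂ⟦X⟧) :
    Omega m (X ^ (5 * k) * f) = X ^ k * Omega m f := by
  ext n
  rw [Omega, coeff_mk, coeff_X_pow_mul', coeff_X_pow_mul']
  by_cases h : k ≤ n
  · rw [if_pos h, if_pos (by omega), Omega, coeff_mk]
    congr 2
    omega
  · rw [if_neg h, if_neg (by omega)]

theorem Omega_qPoch_mul {m : ℕ} (hm : m ≤ 4) (N : ℕ) (f : ℂ⟦X⟧) :
    Omega m (qPoch 5 N * f) = qPoch 1 N * Omega m f := by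
  induction N with
  | zero => simp [qPoch_zero]
  | succ N ih =>
    rw [qPoch_succ, qPoch_succ, one_mul, mul_right_comm, mul_one_sub, mul_comm (_ * f) (X ^ _),
      Omega_sub, Omega_X_pow_mul hm, ih]
    ring

theorem Omega_eulerPow_mul {m : ℕ} (hm : m ≤ 4) (f : ℂ⟦X⟧) :
    Omega m (eulerPow 5 * f) = euler * Omega m f := by
  have h5 : (5 : ℕ) ≠ 0 := by norm_num
  have h1 := (tendsto_qPoch h5).mul_const f
  have h2 := (tendsto_qPoch one_ne_zero).mul_const (Omega m f)
  rw [WithPiTopology.tendsto_iff_coeff_tendsto] at h1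
  rw [← eulerPow_one]
  refine tendsto_nhds_unique ?_ h2
  rw [WithPiTopology.tendsto_iff_coeff_tendsto]
  intro n
  simp only [← Omega_qPoch_mul hm]
  simpa only [Omega, coeff_mk] using h1 (5 * n + m)

theorem Omega_eulerPow_pow_mul {m : ℕ} (hm : m ≤ 4) (j : ℕ) (f : ℂ⟦X⟧) :
    Omega m (eulerPow 5 ^ j * f) = euler ^ j * Omega m f := by
  induction j with
  | zero => simp
  | succ j ih => rw [pow_succ', mul_assoc, Omega_eulerPow_mul hm, ih]; ring

/-- The sum `1 + 25 + ⋯ + 25^{n-1} = (25^n - 1) / 24`. -/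
def geomShift (n : ℕ) : ℕ := ∑ i ∈ range n, 25 ^ i

theorem geomShift_eq (n : ℕ) : 24 * geomShift n + 1 = 25 ^ n := by
  induction n with
  | zero => simp [geomShift]
  | succ n ih =>
    rw [geomShift, sum_range_succ, ← geomShift, pow_succ]
    omega

theorem coeff_Omega_progSeries (k s m N : ℕ) : coeff N (Omega m (progSeries k s)) =
    (partitionCount (5 ^ (k + 1) * (N : ℤ) + 5 ^ k * m - s) : ℂ) := by
  rw [Omega, coeff_mk, progSeries, coeff_mk]
  congr 2
  push_cast
  ring

/-- Shifting N by 5^{n+1} moves the argument by 25^{n+1}, exactly the next summand of `geomShift`.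
For smaller N the argument is negative and p vanishes. -/
theorem X_pow_mul_Omega_progSeries (n : ℕ) :
    X ^ 5 ^ (n + 1) * Omega 0 (progSeries n (geomShift (n + 1))) =
      progSeries (n + 1) (geomShift (n + 2)) := by
  ext N
  have hs : geomShift (n + 2) = geomShift (n + 1) + 25 ^ (n + 1) := sum_range_succ _ _
  have h25 : (25 : ℤ) ^ (n + 1) = 5 ^ (n + 1) * 5 ^ (n + 1) := by rw [← mul_pow]; norm_num
  rw [coeff_X_pow_mul', coeff_Omega_progSeries, progSeries, coeff_mk, hs]
  split_ifs with h
  · congr 2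
    push_cast [h]
    rw [h25]
    ring
  · rw [partitionCount_of_neg, Nat.cast_zero]
    have h' : (N : ℤ) + 1 ≤ 5 ^ (n + 1) := by exact_mod_cast not_le.mp h
    have hp : (0 : ℤ) < 5 ^ (n + 1) := by positivity
    push_cast
    rw [h25]
    nlinarith [Int.natCast_nonneg (geomShift (n + 1))]

/-- In the inductive step Ω turns the power of P_5 into P_1^{5^{n+1}}; the factor L^{5^{n+1}}
cancels it and supplies the next power of P_5 together with the shift q^{5^{n+1}}. -/
theorem F_eq (n : ℕ) : F n = eulerPow 5 ^ 5 ^ (n + 1) * progSeries n (geomShift (n + 1)) := by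
  induction n with
  | zero =>
    have hs : geomShift (0 + 1) = 1 := by simp [geomShift]
    rw [F, hs, progSeries_zero_one]
    linear_combination progSeries 0 0 * L_mul_euler - L * progSeries_zero_zero_mul_euler
  | succ n ih =>
    have h : L ^ 5 ^ (n + 1) * euler ^ 5 ^ (n + 1) =
        X ^ 5 ^ (n + 1) * eulerPow 5 ^ 5 ^ (n + 1 + 1) := by
      rw [← mul_pow, L_mul_euler, mul_pow, ← pow_mul, ← pow_succ']
    rw [F, ih, Omega_eulerPow_pow_mul (Nat.zero_le 4), ← X_pow_mul_Omega_progSeries]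
    linear_combination Omega 0 (progSeries n (geomShift (n + 1))) * h

/-! ### The denominator, the residue δ_k and the final comparison -/

/-- Telescoping: with r = 2j + x, L^{5^r} turns P_1^{5^r} into q^{5^r} P_5^{5^{r+1}}, and
E^{5^{r+1}} turns that power of P_5 into P_1^{5^{r+2}}. -/
theorem prod_mul_euler_pow (x t : ℕ) :
    (∏ j ∈ range t, E ^ 5 ^ (2 * j + 1 + x) * L ^ 5 ^ (2 * j + x)) * euler ^ 5 ^ x =
      X ^ (∑ j ∈ range t, 5 ^ (2 * j + x)) * euler ^ 5 ^ (2 * t + x) := by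
  induction t with
  | zero => simp
  | succ t ih =>
    rw [prod_range_succ, sum_range_succ, pow_add X]
    have h1 : L ^ 5 ^ (2 * t + x) * euler ^ 5 ^ (2 * t + x) =
        X ^ 5 ^ (2 * t + x) * eulerPow 5 ^ 5 ^ (2 * t + 1 + x) := by
      rw [← mul_pow, L_mul_euler, mul_pow, ← pow_mul, ← pow_succ', add_right_comm (2 * t) x 1]
    have h2 : E ^ 5 ^ (2 * t + 1 + x) * eulerPow 5 ^ 5 ^ (2 * t + 1 + x) =
        euler ^ 5 ^ (2 * (t + 1) + x) := by
      rw [← mul_pow, E_mul_eulerPow_five, ← pow_mul, ← pow_succ',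
        show 2 * t + 1 + x + 1 = 2 * (t + 1) + x by ring]
    linear_combination E ^ 5 ^ (2 * t + 1 + x) * L ^ 5 ^ (2 * t + x) * ih +
      X ^ (∑ j ∈ range t, 5 ^ (2 * j + x)) * E ^ 5 ^ (2 * t + 1 + x) * h1 +
      X ^ (∑ j ∈ range t, 5 ^ (2 * j + x)) * X ^ 5 ^ (2 * t + x) * h2

theorem sum_five_pow (x t : ℕ) :
    24 * ∑ j ∈ range t, 5 ^ (2 * j + x) + 5 ^ x = 5 ^ (2 * t + x) := by
  induction t with
  | zero => simp
  | succ t ih =>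
    rw [sum_range_succ, show 2 * (t + 1) + x = (2 * t + x) + 2 by ring, pow_add 5 (2 * t + x) 2]
    omega

theorem two_mul_div_add_chi2 (k : ℕ) : 2 * (k / 2) + chi2 k = k ∧ chi2 k ≤ 1 := by
  rw [chi2]
  split_ifs with h
  · rw [Nat.coprime_two_right] at h
    obtain ⟨j, rfl⟩ := h
    omega
  · rw [Nat.coprime_two_right, Nat.not_odd_iff_even] at h
    obtain ⟨j, rfl⟩ := h
    omega

/-- Both sides are inverses of 24 modulo 5^k. Since 24 times the right side is 5^k(24 - 5^x) + 1
with 1 ≤ 5^x ≤ 5, they differ by less than 5^k and hence agree. -/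
theorem residue_eq {k δ D x : ℕ} (hk : k ≠ 0) (hδ_lt : δ < 5 ^ k) (hδ : 24 * δ ≡ 1 [MOD 5 ^ k])
    (hx : x ≤ 1)
    (hD : 24 * D + 5 ^ x = 5 ^ k) : (δ : ℤ) = 5 ^ k * (1 + D) - geomShift k := by
  have hg : (24 * geomShift k + 1 : ℤ) = 5 ^ k * 5 ^ k := by
    rw [← mul_pow]; exact_mod_cast geomShift_eq k
  have hD' : (24 * D + 5 ^ x : ℤ) = 5 ^ k := by exact_mod_cast hD
  have hlt : (δ : ℤ) < 5 ^ k := by exact_mod_cast hδ_lt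
  have hdvd : (5 ^ k : ℤ) ∣ 24 * (δ : ℤ) - 1 := by
    have := (Nat.modEq_iff_dvd.mp hδ.symm)
    push_cast at this
    exact this
  have hx1 : (1 : ℤ) ≤ 5 ^ x ∧ (5 ^ x : ℤ) ≤ 5 := by
    interval_cases x <;> norm_num
  have h24 : 24 * (5 ^ k * (1 + D) - geomShift k : ℤ) = 5 ^ k * (24 - 5 ^ x) + 1 := by
    linear_combination -hg + 5 ^ k * hD'
  have hcop : IsCoprime (5 ^ k : ℤ) 24 := IsCoprime.pow_left ⟨5, -1, by norm_num⟩
  have hd2 : (5 ^ k : ℤ) ∣ (δ : ℤ) - (5 ^ k * (1 + D) - geomShift k) := by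
    refine hcop.dvd_of_dvd_mul_left ?_
    rw [mul_sub, h24, show 24 * (δ : ℤ) - (5 ^ k * (24 - 5 ^ x) + 1) =
      (24 * δ - 1) - 5 ^ k * (24 - 5 ^ x) by ring]
    exact dvd_sub hdvd (dvd_mul_right _ _)
  have hp : (1 : ℤ) < 5 ^ k := one_lt_pow₀ (by norm_num) hk
  have hmul := mul_nonneg (zero_le_one.trans hp.le) (sub_nonneg.mpr hx1.1)
  have hmul' := mul_nonneg (zero_le_one.trans hp.le) (sub_nonneg.mpr hx1.2)
  have := Int.eq_zero_of_abs_lt_dvd hd2 (abs_lt.mpr ⟨by nlinarith, by nlinarith⟩)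
  linarith

theorem X_pow_mul_partitionSeries {k m δ D : ℕ} (hk : 1 ≤ k) (hm : m ≤ 4)
    (hδ_lt : δ < 5 ^ k) (hδ : (δ : ℤ) = 5 ^ k * (1 + D) - geomShift k) :
    X ^ D * partitionSeries k δ m = Omega m (progSeries (k - 1) (geomShift k)) := by
  ext N
  obtain ⟨k, rfl⟩ := Nat.exists_eq_add_of_le' hk
  rw [coeff_Omega_progSeries, coeff_X_pow_mul', partitionSeries, coeff_mk, Nat.add_sub_cancel]
  split_ifs with h
  · congr 2
    push_cast [h]
    linear_combination hδ
  -- For N < D the argument is at most -2·5^{k+1} + δ + 4·5^k in the shifted index, hence negative.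
  · rw [partitionCount_of_neg, Nat.cast_zero]
    have h' : (N : ℤ) + 1 ≤ D := by exact_mod_cast not_le.mp h
    have hlt : (δ : ℤ) < 5 ^ (k + 1) := by exact_mod_cast hδ_lt
    have hp : (0 : ℤ) < 5 ^ k := by positivity
    have hm' : (m : ℤ) ≤ 4 := by exact_mod_cast hm
    rw [pow_succ] at *
    nlinarith

end

end QuinticPartition

theorem theorem5p3 (k : ℕ) (hk : 2 ≤ k) (m : ℕ) (hm : m ≤ 4)
    (δ : ℕ) (hδ_lt : δ < 5 ^ k) (hδ : 24 * δ ≡ 1 [MOD 5 ^ k]) :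
    QuinticPartition.denom k ≠ 0 ∧
      ((QuinticPartition.euler ^ (5 ^ QuinticPartition.chi2 k) *
          QuinticPartition.partitionSeries k δ m : PowerSeries ℂ) : LaurentSeries ℂ) =
        (QuinticPartition.Fm (k - 1) m : LaurentSeries ℂ) /
          (QuinticPartition.denom k : LaurentSeries ℂ) := by
  open QuinticPartition in
  obtain ⟨hk2, hx⟩ := two_mul_div_add_chi2 k
  have hE : euler ≠ 0 := by
    rw [← eulerPow_one]; exact eulerPow_ne_zero one_ne_zero
  have hden := prod_mul_euler_pow (chi2 k) (k / 2)
  have hD := sum_five_pow (chi2 k) (k / 2)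
  rw [hk2] at hden hD
  rw [← denom] at hden
  have hne : denom k ≠ 0 := by
    intro h
    rw [h, zero_mul] at hden
    exact mul_ne_zero (pow_ne_zero _ PowerSeries.X_ne_zero) (pow_ne_zero _ hE) hden.symm
  have hser := X_pow_mul_partitionSeries (by omega) hm hδ_lt (residue_eq (by omega) hδ_lt hδ hx hD)
  have hF : Fm (k - 1) m = euler ^ 5 ^ k * Omega m (progSeries (k - 1) (geomShift k)) := by
    rw [Fm, F_eq, Omega_eulerPow_pow_mul hm, Nat.sub_add_cancel (by omega)]
  refine ⟨hne, ?_⟩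
  have hne' : (denom k : LaurentSeries ℂ) ≠ 0 := by
    rw [Ne, ← PowerSeries.coe_zero, HahnSeries.ofPowerSeries_injective.eq_iff]
    exact hne
  rw [eq_div_iff hne', ← PowerSeries.coe_mul]
  congr 1
  -- Both sides carry the same partition series; what remains is the telescoped identity for the
  -- denominator.
  rw [hF, ← hser]
  linear_combination partitionSeries k δ m * hden
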